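/- Let $n,q\ge 0$ be integers and $L>0$. Let $A_0,A_1,A_2:[0,L]\to\mathbb R^{n\times n}$, $B_1:[0,L]\to\mathbb R^{n\times q}$, $C_a,C_b:[0,L]\to\mathbb R^{q\times n}$ be measurable and essentially bounded, and let $C_1\in\mathbb R^{q\times 4n}$, $D_1\in\mathbb R^{q\times q}$, $B\in\mathbb R^{2n\times 4n}$, where $$B_2:=B\begin{bmatrix} I&0\\ I&LI\\ 0&I\\ 0&I\end{bmatrix}\in\mathbb R^{2n\times 2n}$$ is invertible (so $B$ has row rank $2n$). Let $X$ be the set of $x\in W^{2,2}([0,L];\mathbb R^n)$ with $B\,[x(0);x(L);x_s(0);x_s(L)]=0$, and consider the system $$\dot x(s,t)=A_0(s)x(s,t)+A_1(s)x_s(s,t)+A_2(s)x_{ss}(s,t)+B_1(s)w(t),\qquad Bz(t)=0,\qquad x(s,0)=0,$$ $$y(t)=C_1z(t)+\int_0^L\big(C_a(s)x(s,t)+C_b(s)x_s(s,t)\big)ds+D_1w(t),\qquad z(t)=[x(0,t);x(L,t);x_s(0,t);x_s(L,t)].$$ A solution with input $w:[0,\infty)\to\mathbb R^q$ is a locally absolutely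 continuous $x:[0,\infty)\to L_2([0,L];\mathbb R^n)$ (i.e. $x(t)=\int_0^t\dot x(\tau)\,d\tau$ with $\dot x$ locally Bochner integrable), together with $y:[0,\infty)\to\mathbb R^q$, such that for a.e. $t\ge0$ one has $x(t)\in X$ and the above equations hold (the first one for a.e. $s$). For functions $M:[0,L]\to\mathbb R^{n\times n}$, $N_1,N_2:[0,L]^2\to\mathbb R^{n\times n}$ put $$(\mathcal P_{\{M,N_1,N_2\}}x)(s)=M(s)x(s)+\int_0^sN_1(s,\theta)x(\theta)d\theta+\int_s^LN_2(s,\theta)x(\theta)d\theta ,$$ and for $P\in\mathbb R^{q\times q}$, $Q(s)\in\mathbb R^{q\times n}$, $R_i(s,\theta)\in\mathbb R^{n\times n}$, $x_1\in\mathbb R^q$, $x_2\in L_2([0,L];\mathbb R^n)$, $$\mathcal P_{\{P,Q,R_1,R_2\}}\begin{bmatrix}x_1\\x_2\end{bmatrix}(s)=\begin{bmatrix}Px_1+\frac1L\int_0^LQ(\theta)x_2(\theta)d\theta\\ Q(s)^Tx_1+\int_0^sR_1(s,\theta)x_2(\theta)d\theta+\int_s^LR_2(s,\theta)x_2(\theta)d\theta\end{bmatrix}.$$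 Here $\mathcal P_{\{P,Q,R_1,R_2\}}\le0$ means $\int_0^L v(s)^T(\mathcal P_{\{P,Q,R_1,R_2\}}v)(s)\,ds\le 0$ for all $v(s)=[x_1;x_2(s)]$ with $x_1\in\mathbb R^q$ constant and $x_2\in L_2([0,L];\mathbb R^n)$. With $\mathcal I$ the indicator function of $[0,\infty)$, define $$B_c(\eta)=-B_2^{-1}B\,[0;(L-\eta)I;0;I],\quad B_a(s,\eta)=[I\ \ sI]B_c(\eta),\quad B_b(\eta)=[0\ \ I]B_c(\eta),$$ $$G(s,\eta)=B_a(s,\eta)+\mathcal I(s-\eta)(s-\eta)I,\qquad G_2(s,\eta)=B_b(\eta)+\mathcal I(s-\eta)I,$$ $$C_3(\theta)=C_1\Big(\begin{bmatrix} I&0\\ I&LI\\ 0&I\\ 0&I\end{bmatrix}B_c(\theta)+\begin{bmatrix}0\\(L-\theta)I\\0\\I\end{bmatrix}\Big)+\int_0^L\big(C_a(s)G(s,\theta)+C_b(s)G_2(s,\theta)\big)ds .$$ For functions $M,N_1,N_2$ let $$Y_1(s,\eta)=B_a(\eta,s)^TM(\eta)+\int_\eta^LB_a(\theta,s)^TN_1(\theta,\eta)d\theta+\int_0^\eta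 B_a(\theta,s)^TN_2(\theta,\eta)d\theta,$$ $$Y_2(\zeta)=M(\zeta)+\int_0^\zeta N_1(\zeta,\theta)d\theta+\int_\zeta^LN_2(\zeta,\theta)d\theta,$$ $$Y_3(\zeta,\eta)=M(\zeta)B_a(\zeta,\eta)+\int_0^\zeta N_1(\zeta,\theta)B_a(\theta,\eta)d\theta+\int_\zeta^LN_2(\zeta,\theta)B_a(\theta,\eta)d\theta,$$ $$F_4(\theta,\eta)=M(\eta)+\int_\theta^\eta N_1(\eta,\zeta)d\zeta,\qquad F_5(s,\eta)=\int_s^\eta(\zeta-s)N_2(\zeta,\eta)d\zeta,$$ $$G_4(\theta,\eta)=(\eta-\theta)M(\eta)+\int_\theta^\eta(\zeta-\theta)N_1(\eta,\zeta)d\zeta,\qquad G_5(s,\theta,\eta)=\int_s^\eta(\zeta-s)(\eta-\theta)N_2(\zeta,\eta)d\zeta,$$ $$F_3(s,\eta)=\int_0^LB_a(\zeta,s)^TY_2(\zeta)B_b(\eta)d\zeta+\int_\eta^LY_1(s,\zeta)d\zeta+\int_s^L(\zeta-s)Y_2(\zeta)d\zeta\,B_b(\eta),$$ $$G_3(s,\theta)=\int_0^LB_a(\eta,s)^TY_3(\eta,\theta)d\eta+\int_\theta^L(\eta-\theta)Y_1(s,\eta)d\eta+\int_s^L(\eta-s)Y_3(\eta,\theta)d\eta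 .$$ The maps $\mathcal L_1,\mathcal L_2,\mathcal L_3$ send $(M,N_1,N_2)$ to the following pairs of kernels in $(s,\theta)$: $$\mathcal L_1=\Big(\int_s^L(\eta-s)N_1(\eta,\theta)d\eta+Y_1(s,\theta),\ (\theta-s)M(\theta)+\int_\theta^L(\eta-s)N_1(\eta,\theta)d\eta+\int_s^\theta(\eta-s)N_2(\eta,\theta)d\eta+Y_1(s,\theta)\Big),$$ $$\mathcal L_2=\Big(\int_s^L\big((\eta-s)F_4(\theta,\eta)+F_5(s,\eta)\big)d\eta+F_3(s,\theta),\ \int_\theta^L\big((\eta-s)F_4(\theta,\eta)+F_5(s,\eta)\big)d\eta+F_3(s,\theta)\Big),$$ $$\mathcal L_3=\Big(\int_s^L\big((\eta-s)G_4(\theta,\eta)+G_5(s,\theta,\eta)\big)d\eta+G_3(s,\theta),\ \int_\theta^L\big((\eta-s)G_4(\theta,\eta)+G_5(s,\theta,\eta)\big)d\eta+G_3(s,\theta)\Big).$$ **Theorem.** Suppose there are polynomial matrices $M(s),N_1(s,\theta),N_2(s,\theta)\in\mathbb R^{n\times n}$ such that the operator $\mathcal P_{\{M,N_1,N_2\}}$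 on $L_2([0,L];\mathbb R^n)$ is self-adjoint and coercive ($\langle x,\mathcal P_{\{M,N_1,N_2\}}x\rangle\ge\varepsilon\|x\|^2$ for some $\varepsilon>0$ and all $x$), and such that $\mathcal P_{\{P,Q,R_1,R_2\}}\le0$, where $$P=-\tfrac1L(D_1+D_1^T),\qquad Q(s)=-C_3(s)+\int_0^LV(s,\theta)^Td\theta,$$ $$R_1(s,\theta)=H_1(s,\theta)+H_2(\theta,s)^T,\qquad R_2(s,\theta)=R_1(\theta,s)^T,$$ $$V(s,\eta)=\Big(G(\eta,s)^TM(\eta)+\int_\eta^LG(\beta,s)^TN_1(\beta,\eta)d\beta+\int_0^\eta G(\beta,s)^TN_2(\beta,\eta)d\beta\Big)B_1(\eta),$$ $$(H_1,H_2)=\mathcal L_3(V_0,W_{01},W_{02})+\mathcal L_2(V_1,W_{11},W_{12})+\mathcal L_1(V_2,W_{21},W_{22}),$$ $$V_i(s)=M(s)A_i(s),\qquad W_{ij}(s,\theta)=N_j(s,\theta)A_i(\theta).$$ Then the system is passive: whenever $w,y\in L_2([0,\infty);\mathbb R^q)$ and $x$ satisfy the system above, $\langle w,y\rangle_{L_2}=\int_0^\infty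 w(t)^Ty(t)\,dt\ge0$. -/

import Mathlib

open MeasureTheory Set
open scoped Matrix Kronecker

noncomputable section

namespace CoupledPDE

/-- `ℝ^k` with the Euclidean norm and inner product. -/
abbrev Vec (k : ℕ) := EuclideanSpace ℝ (Fin k)

/-- Matrix times vector. -/
def mv {k l : ℕ} (A : Matrix (Fin k) (Fin l) ℝ) (v : Vec l) : Vec k :=
  WithLp.toLp 2 (A *ᵥ v.ofLp)

/-- Entrywise integral `∫_a^b F(r) dr` of a matrix-valued function. -/
def matInt {k l : ℕ} (a b : ℝ) (F : ℝ → Matrix (Fin k) (Fin l) ℝ) : Matrix (Fin k) (Fin l) ℝ :=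
  Matrix.of fun i j => ∫ r in a..b, F r i j

/-- Lebesgue measure on `[0, L]`. -/
abbrev interval (L : ℝ) : Measure ℝ := volume.restrict (Icc 0 L)

/-- The space `Z = L₂ⁿ([0, L])`. -/
abbrev StateSpace (n : ℕ) (L : ℝ) := Lp (Vec n) 2 (interval L)

/-- A measurable, essentially bounded matrix-valued function on `[0, L]`. -/
def EssBounded {k l : ℕ} (L : ℝ) (A : ℝ → Matrix (Fin k) (Fin l) ℝ) : Prop :=
  ∀ i j, MemLp (fun s => A s i j) ⊤ (interval L)

/-- Data of the coupled PDE system with `n` states, `m` inputs and `q` outputs. The columns of `B`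
and `C₁` are grouped into four blocks of size `n`, matching the stacked vector
`(x(0), x(L), x_s(0), x_s(L))`; the `2n` rows of `B` are grouped into two blocks. -/
structure PDESystem (n m q : ℕ) where
  L : ℝ
  A₀ : ℝ → Matrix (Fin n) (Fin n) ℝ
  A₁ : ℝ → Matrix (Fin n) (Fin n) ℝ
  A₂ : ℝ → Matrix (Fin n) (Fin n) ℝ
  B₁ : ℝ → Matrix (Fin n) (Fin m) ℝ
  C₁ : Matrix (Fin q) (Fin 4 × Fin n) ℝ
  Ca : ℝ → Matrix (Fin q) (Fin n) ℝ
  Cb : ℝ → Matrix (Fin q) (Fin n) ℝ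
  D₁ : Matrix (Fin q) (Fin m) ℝ
  B : Matrix (Fin 2 × Fin n) (Fin 4 × Fin n) ℝ

/-- The block column with blocks `c₀ I, …, c_{k-1} I`. -/
def blockCol (n : ℕ) {k : ℕ} (c : Fin k → ℝ) : Matrix (Fin k × Fin n) (Fin n) ℝ :=
  Matrix.of fun p j => c p.1 * (1 : Matrix (Fin n) (Fin n) ℝ) p.2 j

/-- The block row `[c₀ I, …, c_{k-1} I]`. -/
def blockRow (n : ℕ) {k : ℕ} (c : Fin k → ℝ) : Matrix (Fin n) (Fin k × Fin n) ℝ :=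
  (blockCol n c)ᵀ

/-- The block matrix `[I 0; I L; 0 I; 0 I]`. -/
def bdryMat (n : ℕ) (L : ℝ) : Matrix (Fin 4 × Fin n) (Fin 2 × Fin n) ℝ :=
  (!![1, 0; 1, L; 0, 1; 0, 1] : Matrix (Fin 4) (Fin 2) ℝ) ⊗ₖ (1 : Matrix (Fin n) (Fin n) ℝ)

/-- `B₂ = B [I 0; I L; 0 I; 0 I]`. -/
def bcMat {n : ℕ} (L : ℝ) (B : Matrix (Fin 2 × Fin n) (Fin 4 × Fin n) ℝ) :
    Matrix (Fin 2 × Fin n) (Fin 2 × Fin n) ℝ :=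
  B * bdryMat n L

/-- `B_c(η) = -B₂⁻¹ B [0; L - η; 0; I]`. -/
def Bc {n : ℕ} (L : ℝ) (B : Matrix (Fin 2 × Fin n) (Fin 4 × Fin n) ℝ) (η : ℝ) :
    Matrix (Fin 2 × Fin n) (Fin n) ℝ :=
  -((bcMat L B)⁻¹ * (B * blockCol n ![0, L - η, 0, 1]))

/-- `B_a(s, η) = [I sI] B_c(η)`. -/
def Ba {n : ℕ} (L : ℝ) (B : Matrix (Fin 2 × Fin n) (Fin 4 × Fin n) ℝ) (s η : ℝ) :
    Matrix (Fin n) (Fin n) ℝ :=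
  blockRow n ![1, s] * Bc L B η

/-- `B_b(η) = [0 I] B_c(η)`. -/
def Bb {n : ℕ} (L : ℝ) (B : Matrix (Fin 2 × Fin n) (Fin 4 × Fin n) ℝ) (η : ℝ) :
    Matrix (Fin n) (Fin n) ℝ :=
  blockRow n ![0, 1] * Bc L B η

/-- The indicator `𝓘` of `[0, ∞)`. -/
def ind (r : ℝ) : ℝ := if 0 ≤ r then 1 else 0

/-- `G(s, η) = G₁(s, η) = [I sI] B_c(η) + 𝓘(s - η)(s - η) I`. -/
def G₁ {n : ℕ} (L : ℝ) (B : Matrix (Fin 2 × Fin n) (Fin 4 × Fin n) ℝ) (s η : ℝ) :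
    Matrix (Fin n) (Fin n) ℝ :=
  blockRow n ![1, s] * Bc L B η + (ind (s - η) * (s - η)) • 1

/-- `G₂(s, η) = [0 I] B_c(η) + 𝓘(s - η) I`. -/
def G₂ {n : ℕ} (L : ℝ) (B : Matrix (Fin 2 × Fin n) (Fin 4 × Fin n) ℝ) (s η : ℝ) :
    Matrix (Fin n) (Fin n) ℝ :=
  blockRow n ![0, 1] * Bc L B η + ind (s - η) • 1

/-- The kernel `C₃` of the output operator `𝒞 x = ∫₀ᴸ C₃(s) x_ss(s) ds`. -/
def C₃ {n m q : ℕ} (S : PDESystem n m q) (θ : ℝ) : Matrix (Fin q) (Fin n) ℝ :=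
  S.C₁ * (bdryMat n S.L * Bc S.L S.B θ + blockCol n ![0, S.L - θ, 0, 1])
    + matInt 0 S.L fun s => S.Ca s * G₁ S.L S.B s θ + S.Cb s * G₂ S.L S.B s θ

/-! ### Operators -/

/-- The operator `𝒫_{M,N₁,N₂}`. -/
def opP {n : ℕ} (L : ℝ) (M : ℝ → Matrix (Fin n) (Fin n) ℝ)
    (N₁ N₂ : ℝ → ℝ → Matrix (Fin n) (Fin n) ℝ) (x : ℝ → Vec n) (s : ℝ) : Vec n :=
  mv (M s) (x s) + (∫ θ in (0 : ℝ)..s, mv (N₁ s θ) (x θ)) + ∫ θ in s..L, mv (N₂ s θ) (x θ)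

/-- The inner product `∫₀ᴸ x(s)ᵀ y(s) ds`. -/
def ip {k : ℕ} (L : ℝ) (x y : ℝ → Vec k) : ℝ := ∫ s in (0 : ℝ)..L, inner ℝ (x s) (y s)

/-- `⟨x, T x⟩ ≥ ε ‖x‖²` on `L₂ⁿ([0, L])`, for some `ε > 0`. -/
def IsCoerciveOp {n : ℕ} (L : ℝ) (T : (ℝ → Vec n) → ℝ → Vec n) : Prop :=
  ∃ ε : ℝ, 0 < ε ∧ ∀ x : ℝ → Vec n, MemLp x 2 (interval L) → ε * ip L x x ≤ ip L x (T x)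

/-- `⟨T x, y⟩ = ⟨x, T y⟩` on `L₂ⁿ([0, L])`. -/
def IsSelfAdjointOp {n : ℕ} (L : ℝ) (T : (ℝ → Vec n) → ℝ → Vec n) : Prop :=
  ∀ x y : ℝ → Vec n, MemLp x 2 (interval L) → MemLp y 2 (interval L) →
    ip L (T x) y = ip L x (T y)

/-- First component of `𝒫_{P,Q,R₁,R₂}(x₁, x₂)`. -/
def opPQRSfst {n m : ℕ} (L : ℝ) (P : Matrix (Fin m) (Fin m) ℝ) (Q : ℝ → Matrix (Fin m) (Fin n) ℝ)
    (x₁ : Vec m) (x₂ : ℝ → Vec n) : Vec m :=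
  mv P x₁ + (1 / L) • ∫ s in (0 : ℝ)..L, mv (Q s) (x₂ s)

/-- Second component of `𝒫_{P,Q,R₁,R₂}(x₁, x₂)`. -/
def opPQRSsnd {n m : ℕ} (L : ℝ) (Q : ℝ → Matrix (Fin m) (Fin n) ℝ)
    (R₁ R₂ : ℝ → ℝ → Matrix (Fin n) (Fin n) ℝ) (x₁ : Vec m) (x₂ : ℝ → Vec n) (s : ℝ) : Vec n :=
  mv (Q s)ᵀ x₁ + (∫ θ in (0 : ℝ)..s, mv (R₁ s θ) (x₂ θ)) + ∫ θ in s..L, mv (R₂ s θ) (x₂ θ)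

/-- `𝒫_{P,Q,R₁,R₂} ≤ 0` on `ℝᵐ × L₂ⁿ([0, L])`; a vector `x₁` is regarded as a constant function,
so that the inner product of `(x₁, x₂)` and `(y₁, y₂)` is `∫₀ᴸ (x₁ᵀ y₁ + x₂(s)ᵀ y₂(s)) ds`. -/
def PQRSNonpos {n m : ℕ} (L : ℝ) (P : Matrix (Fin m) (Fin m) ℝ) (Q : ℝ → Matrix (Fin m) (Fin n) ℝ)
    (R₁ R₂ : ℝ → ℝ → Matrix (Fin n) (Fin n) ℝ) : Prop :=
  ∀ (x₁ : Vec m) (x₂ : ℝ → Vec n), MemLp x₂ 2 (interval L) →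
    ip L (fun _ => x₁) (fun _ => opPQRSfst L P Q x₁ x₂)
      + ip L x₂ (opPQRSsnd L Q R₁ R₂ x₁ x₂) ≤ 0

/-! ### The maps `𝓛₁`, `𝓛₂`, `𝓛₃` -/

section maps

variable {n : ℕ} (L : ℝ) (B : Matrix (Fin 2 × Fin n) (Fin 4 × Fin n) ℝ)
  (M : ℝ → Matrix (Fin n) (Fin n) ℝ) (N₁ N₂ : ℝ → ℝ → Matrix (Fin n) (Fin n) ℝ)

def Y₁ (s η : ℝ) : Matrix (Fin n) (Fin n) ℝ :=
  (Ba L B η s)ᵀ * M η + matInt η L (fun θ => (Ba L B θ s)ᵀ * N₁ θ η)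
    + matInt 0 η fun θ => (Ba L B θ s)ᵀ * N₂ θ η

def Y₂ (ζ : ℝ) : Matrix (Fin n) (Fin n) ℝ :=
  M ζ + matInt 0 ζ (fun θ => N₁ ζ θ) + matInt ζ L fun θ => N₂ ζ θ

def Y₃ (ζ η : ℝ) : Matrix (Fin n) (Fin n) ℝ :=
  M ζ * Ba L B ζ η + matInt 0 ζ (fun θ => N₁ ζ θ * Ba L B θ η)
    + matInt ζ L fun θ => N₂ ζ θ * Ba L B θ η

def kerE₁ (s θ : ℝ) : Matrix (Fin n) (Fin n) ℝ :=
  matInt s L fun η => (η - s) • N₁ η θ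

def kerE₂ (s θ : ℝ) : Matrix (Fin n) (Fin n) ℝ :=
  (θ - s) • M θ + matInt θ L (fun η => (η - s) • N₁ η θ) + matInt s θ fun η => (η - s) • N₂ η θ

def kerF₄ (θ η : ℝ) : Matrix (Fin n) (Fin n) ℝ :=
  M η + matInt θ η fun ζ => N₁ η ζ

def kerF₅ (s η : ℝ) : Matrix (Fin n) (Fin n) ℝ :=
  matInt s η fun ζ => (ζ - s) • N₂ ζ η

def kerF₁ (s θ : ℝ) : Matrix (Fin n) (Fin n) ℝ :=
  matInt s L fun η => (η - s) • kerF₄ M N₁ θ η + kerF₅ N₂ s η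

def kerF₂ (s θ : ℝ) : Matrix (Fin n) (Fin n) ℝ :=
  matInt θ L fun η => (η - s) • kerF₄ M N₁ θ η + kerF₅ N₂ s η

def kerF₃ (s η : ℝ) : Matrix (Fin n) (Fin n) ℝ :=
  matInt 0 L (fun ζ => (Ba L B ζ s)ᵀ * Y₂ L M N₁ N₂ ζ * Bb L B η)
    + matInt η L (fun ζ => Y₁ L B M N₁ N₂ s ζ)
    + matInt s L (fun ζ => (ζ - s) • Y₂ L M N₁ N₂ ζ) * Bb L B η

def kerG₄ (θ η : ℝ) : Matrix (Fin n) (Fin n) ℝ :=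
  (η - θ) • M η + matInt θ η fun ζ => (ζ - θ) • N₁ η ζ

def kerG₅ (s θ η : ℝ) : Matrix (Fin n) (Fin n) ℝ :=
  matInt s η fun ζ => ((ζ - s) * (η - θ)) • N₂ ζ η

def kerG₁ (s θ : ℝ) : Matrix (Fin n) (Fin n) ℝ :=
  matInt s L fun η => (η - s) • kerG₄ M N₁ θ η + kerG₅ N₂ s θ η

def kerG₂ (s θ : ℝ) : Matrix (Fin n) (Fin n) ℝ :=
  matInt θ L fun η => (η - s) • kerG₄ M N₁ θ η + kerG₅ N₂ s θ η

def kerG₃ (s θ : ℝ) : Matrix (Fin n) (Fin n) ℝ :=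
  matInt 0 L (fun η => (Ba L B η s)ᵀ * Y₃ L B M N₁ N₂ η θ)
    + matInt θ L (fun η => (η - θ) • Y₁ L B M N₁ N₂ s η)
    + matInt s L fun η => (η - s) • Y₃ L B M N₁ N₂ η θ

/-- `𝓛₁(M, N₁, N₂)`, representing `⟨x, 𝒫_{M,N₁,N₂} x_ss⟩` through `x_ss`. -/
def map₁ : (ℝ → ℝ → Matrix (Fin n) (Fin n) ℝ) × (ℝ → ℝ → Matrix (Fin n) (Fin n) ℝ) :=
  (fun s θ => kerE₁ L N₁ s θ + Y₁ L B M N₁ N₂ s θ,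
   fun s θ => kerE₂ L M N₁ N₂ s θ + Y₁ L B M N₁ N₂ s θ)

/-- `𝓛₂(M, N₁, N₂)`, representing `⟨x, 𝒫_{M,N₁,N₂} x_s⟩` through `x_ss`. -/
def map₂ : (ℝ → ℝ → Matrix (Fin n) (Fin n) ℝ) × (ℝ → ℝ → Matrix (Fin n) (Fin n) ℝ) :=
  (fun s θ => kerF₁ L M N₁ N₂ s θ + kerF₃ L B M N₁ N₂ s θ,
   fun s θ => kerF₂ L M N₁ N₂ s θ + kerF₃ L B M N₁ N₂ s θ)

/-- `𝓛₃(M, N₁, N₂)`, representing `⟨x, 𝒫_{M,N₁,N₂} x⟩` through `x_ss`. -/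
def map₃ : (ℝ → ℝ → Matrix (Fin n) (Fin n) ℝ) × (ℝ → ℝ → Matrix (Fin n) (Fin n) ℝ) :=
  (fun s θ => kerG₁ L M N₁ N₂ s θ + kerG₃ L B M N₁ N₂ s θ,
   fun s θ => kerG₂ L M N₁ N₂ s θ + kerG₃ L B M N₁ N₂ s θ)

end maps

/-! ### The matrices and kernels `P`, `Q`, `R₁`, `R₂` of the passivity test -/

section test

variable {n q : ℕ} (S : PDESystem n q q)
  (M : ℝ → Matrix (Fin n) (Fin n) ℝ) (N₁ N₂ : ℝ → ℝ → Matrix (Fin n) (Fin n) ℝ)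

/-- `V(s, η)`; the kernel with `⟨x, 𝒫_{M,N₁,N₂} ℬ w⟩ = ∫₀ᴸ x_ss(s)ᵀ (∫₀ᴸ V(s, η) dη) w ds`. -/
def kerV (s η : ℝ) : Matrix (Fin n) (Fin q) ℝ :=
  ((G₁ S.L S.B η s)ᵀ * M η + matInt η S.L (fun β => (G₁ S.L S.B β s)ᵀ * N₁ β η)
    + matInt 0 η fun β => (G₁ S.L S.B β s)ᵀ * N₂ β η) * S.B₁ η

def passP : Matrix (Fin q) (Fin q) ℝ := -((1 / S.L) • (S.D₁ + S.D₁ᵀ))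

def passQ (s : ℝ) : Matrix (Fin q) (Fin n) ℝ :=
  -C₃ S s + matInt 0 S.L fun θ => (kerV S M N₁ N₂ s θ)ᵀ

/-- `(H₁, H₂) = 𝓛₃(V₀, W₀₁, W₀₂) + 𝓛₂(V₁, W₁₁, W₁₂) + 𝓛₁(V₂, W₂₁, W₂₂)` with
`Vᵢ(s) = M(s) Aᵢ(s)` and `Wᵢⱼ(s, θ) = Nⱼ(s, θ) Aᵢ(θ)`. -/
def passH : (ℝ → ℝ → Matrix (Fin n) (Fin n) ℝ) × (ℝ → ℝ → Matrix (Fin n) (Fin n) ℝ) :=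
  map₃ S.L S.B (fun s => M s * S.A₀ s) (fun s θ => N₁ s θ * S.A₀ θ) (fun s θ => N₂ s θ * S.A₀ θ)
  + map₂ S.L S.B (fun s => M s * S.A₁ s) (fun s θ => N₁ s θ * S.A₁ θ) (fun s θ => N₂ s θ * S.A₁ θ)
  + map₁ S.L S.B (fun s => M s * S.A₂ s) (fun s θ => N₁ s θ * S.A₂ θ) (fun s θ => N₂ s θ * S.A₂ θ)

def passR₁ (s θ : ℝ) : Matrix (Fin n) (Fin n) ℝ :=
  (passH S M N₁ N₂).1 s θ + ((passH S M N₁ N₂).2 θ s)ᵀ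

def passR₂ (s θ : ℝ) : Matrix (Fin n) (Fin n) ℝ := (passR₁ S M N₁ N₂ θ s)ᵀ

end test

/-! ### Solutions -/

/-- `u ∈ W^{2,n}([0, L])` with derivatives `us` and `uss`, where `u` is the `C¹` representative:
`us` is absolutely continuous with derivative `uss ∈ L₂`. -/
structure IsW2 {n : ℕ} (L : ℝ) (u us uss : ℝ → Vec n) : Prop where
  memLp : MemLp uss 2 (interval L)
  deriv₁ : ∀ s ∈ Icc 0 L, u s = u 0 + ∫ r in (0 : ℝ)..s, us r
  deriv₂ : ∀ s ∈ Icc 0 L, us s = us 0 + ∫ r in (0 : ℝ)..s, uss r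

/-- The stacked vector `(u(0), u(L), u_s(0), u_s(L))`. -/
def bdryVec {n : ℕ} (L : ℝ) (u us : ℝ → Vec n) : Fin 4 × Fin n → ℝ :=
  fun p => (![u 0, u L, us 0, us L] p.1).ofLp p.2

/-- `x : [0, ∞) → L₂ⁿ([0, L])` and `y` are a (strong) solution of the system with input `w`:
`x` is locally absolutely continuous with `x(0) = 0` and derivative `xdot`, and for almost every
`t ≥ 0` the state `x(t)` lies in `X` (it is in `W^{2,n}` and satisfies the boundary conditions) and
the state and output equations hold. -/
def IsSolution {n m q : ℕ} (S : PDESystem n m q) (w : ℝ → Vec m) (x : ℝ → StateSpace n S.L)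
    (y : ℝ → Vec q) : Prop :=
  ∃ xdot : ℝ → StateSpace n S.L,
    (∀ T : ℝ, 0 ≤ T → IntervalIntegrable xdot volume 0 T) ∧
    (∀ t : ℝ, 0 ≤ t → x t = ∫ τ in (0 : ℝ)..t, xdot τ) ∧
    ∀ᵐ t ∂(volume.restrict (Ici (0 : ℝ))), ∃ u us uss : ℝ → Vec n,
      IsW2 S.L u us uss ∧
      (x t : ℝ → Vec n) =ᵐ[interval S.L] u ∧
      S.B *ᵥ bdryVec S.L u us = 0 ∧
      ((xdot t : ℝ → Vec n) =ᵐ[interval S.L] fun s =>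
        mv (S.A₀ s) (u s) + mv (S.A₁ s) (us s) + mv (S.A₂ s) (uss s) + mv (S.B₁ s) (w t)) ∧
      y t = WithLp.toLp 2 (S.C₁ *ᵥ bdryVec S.L u us)
        + (∫ s in (0 : ℝ)..S.L, (mv (S.Ca s) (u s) + mv (S.Cb s) (us s))) + mv S.D₁ (w t)

/-- The matrix-valued function of a matrix of one-variable polynomials. -/
def polyFun {n : ℕ} (M : Matrix (Fin n) (Fin n) (Polynomial ℝ)) (s : ℝ) :
    Matrix (Fin n) (Fin n) ℝ :=
  M.map (Polynomial.eval s)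

/-- The matrix-valued function of a matrix of two-variable polynomials. -/
def polyFun₂ {n : ℕ} (N : Matrix (Fin n) (Fin n) (MvPolynomial (Fin 2) ℝ)) (s θ : ℝ) :
    Matrix (Fin n) (Fin n) ℝ :=
  N.map (MvPolynomial.eval ![s, θ])

end CoupledPDE

end

/-! The storage function is E(x) = ⟨x, 𝒫x⟩ with 𝒫 = 𝒫_{M,N₁,N₂}. Self-adjointness gives E(x(τ)) =
2∫₀^τ ⟨x, 𝒫ẋ⟩ dt along a solution starting at zero, and coercivity gives E ≥ 0. Once ⟨x, 𝒫ẋ⟩ ≤ wᵀy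
is known at almost every time (`ip_opP_stateRhs_le`), it follows that 0 ≤ 2∫₀^τ wᵀy for every τ, and
τ → ∞ concludes.

The inequality at a fixed time is algebra in x_ss. Taylor's formula expresses x, x_s and the
boundary values through x(0), x_s(0) and x_ss; because B₂ is invertible, the boundary conditions
determine x(0) and x_s(0). Hence x = ∫ G₁ x_ss, x_s = ∫ G₂ x_ss and y = ∫ C₃ x_ss + D₁ w
(`IsW2.u_eq_MI`, `IsW2.us_eq_MI`, `colVec_output`). After moving 𝒫 onto G₁ by Fubini
(`MI_PK_eq_MI_PKt`), ⟨x, 𝒫ẋ⟩ becomes ∫∫ x_ssᵀ H x_ss + ∫ x_ssᵀ (∫V) w with H = `stateKernel`. The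
form of 𝒫_{P,Q,R₁,R₂} at (w, x_ss) is then exactly 2(⟨x, 𝒫ẋ⟩ - wᵀy), so the sign condition is the
dissipation inequality.

The laborious part is to recognise H in the explicit maps 𝓛ᵢ. Splitting G₁ and G₂ into a boundary
part and a ramp or step produces four terms (`MI_G₁_PK`). The two components of each 𝓛ᵢ turn out to
be the values of one composed kernel below and above the diagonal; the diagonal is a null set.

The energy identity (`inner_primitive_eq`) is obtained without differentiating E: the integral of
⟨ẋ(a), 𝒫ẋ(b)⟩ over the square [0, τ]² is twice its integral over a triangle.

Two conventions make Fubini and transposition uniform: variable limits of integration become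
indicator factors under the fixed measure on [0, L], and vectors become one-column matrices. -/

noncomputable section

namespace CoupledPDE

/-! ### Entrywise integrals of matrix-valued functions -/

section calculus

variable {α β : Type*} [MeasurableSpace α] [MeasurableSpace β] {μ : Measure α} {ν : Measure β}
  {k l m : Type*} {p : ENNReal}

/-- Entrywise integral of a matrix-valued function with respect to a measure. -/
def MI (μ : Measure α) (F : α → Matrix k l ℝ) : Matrix k l ℝ :=
  Matrix.of fun i j => ∫ a, F a i j ∂μ

/-- All entries of a matrix-valued function are in `Lᵖ`. -/
def MLp (p : ENNReal) (μ : Measure α) (F : α → Matrix k l ℝ) : Prop :=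
  ∀ i j, MemLp (fun a => F a i j) p μ

theorem MI_apply (F : α → Matrix k l ℝ) (i : k) (j : l) : MI μ F i j = ∫ a, F a i j ∂μ := rfl

theorem MLp.integrable {F : α → Matrix k l ℝ} (hF : MLp 1 μ F) (i : k) (j : l) :
    Integrable (fun a => F a i j) μ := memLp_one_iff_integrable.1 (hF i j)

theorem MLp.of_integrable {F : α → Matrix k l ℝ}
    (hF : ∀ i j, Integrable (fun a => F a i j) μ) : MLp 1 μ F :=
  fun i j => memLp_one_iff_integrable.2 (hF i j)

theorem MLp.add {F G : α → Matrix k l ℝ} (hF : MLp p μ F) (hG : MLp p μ G) :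
    MLp p μ fun a => F a + G a := fun i j => (hF i j).add (hG i j)

theorem MLp.neg {F : α → Matrix k l ℝ} (hF : MLp p μ F) : MLp p μ fun a => -F a :=
  fun i j => (hF i j).neg

theorem MLp.transpose {F : α → Matrix k l ℝ} (hF : MLp p μ F) : MLp p μ fun a => (F a)ᵀ :=
  fun i j => hF j i

theorem MLp.const (A : Matrix k l ℝ) : MLp ⊤ μ fun _ : α => A := fun i j => memLp_top_const (A i j)

theorem MLp.smul_top {F : α → Matrix k l ℝ} {g : α → ℝ} (hg : MemLp g ⊤ μ) (hF : MLp p μ F) :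
    MLp p μ fun a => g a • F a := fun i j => (hF i j).mul' (p := ⊤) (q := p) hg

theorem MLp.mono_exponent [IsFiniteMeasure μ] {p' : ENNReal} {F : α → Matrix k l ℝ}
    (hF : MLp p' μ F) (h : p ≤ p') : MLp p μ F := fun i j => (hF i j).mono_exponent h

theorem MLp.congr {F G : α → Matrix k l ℝ} (hF : MLp p μ F) (h : ∀ᵐ a ∂μ, F a = G a) :
    MLp p μ G := fun i j => (hF i j).ae_eq (h.mono fun a ha => by simp [ha])

theorem MLp.fst [IsFiniteMeasure ν] {F : α → Matrix k l ℝ} (hF : MLp p μ F) :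
    MLp p (μ.prod ν) fun a => F a.1 := fun i j => (hF i j).comp_fst ν

theorem MLp.snd [IsFiniteMeasure μ] [SFinite ν] {F : β → Matrix k l ℝ} (hF : MLp p ν F) :
    MLp p (μ.prod ν) fun a => F a.2 := fun i j => (hF i j).comp_snd μ

theorem MLp.swap [SFinite μ] [SFinite ν] {F : α × β → Matrix k l ℝ} (hF : MLp p (μ.prod ν) F) :
    MLp p (ν.prod μ) fun a => F a.swap := fun i j =>
  (hF i j).comp_measurePreserving Measure.measurePreserving_swap

theorem MLp.topMul [Fintype l] {F : α → Matrix k l ℝ} {G : α → Matrix l m ℝ} (hF : MLp ⊤ μ F)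
    (hG : MLp p μ G) : MLp p μ fun a => F a * G a := fun i j => by
  simp only [Matrix.mul_apply]
  exact memLp_finsetSum _ fun x _ => (hG x j).mul' (p := ⊤) (q := p) (hF i x)

theorem MLp.mulTop [Fintype l] {F : α → Matrix k l ℝ} {G : α → Matrix l m ℝ} (hF : MLp p μ F)
    (hG : MLp ⊤ μ G) : MLp p μ fun a => F a * G a := fun i j => by
  simp only [Matrix.mul_apply]
  exact memLp_finsetSum _ fun x _ => (hG x j).mul' (p := p) (q := ⊤) (hF i x)

theorem MLp.mul_two [Fintype l] {F : α → Matrix k l ℝ} {G : α → Matrix l m ℝ} (hF : MLp 2 μ F)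
    (hG : MLp 2 μ G) : MLp 1 μ fun a => F a * G a := fun i j => by
  simp only [Matrix.mul_apply]
  exact memLp_finsetSum _ fun x _ => (hG x j).mul' (p := 2) (q := 2) (hF i x)

theorem MI_add {F G : α → Matrix k l ℝ} (hF : MLp 1 μ F) (hG : MLp 1 μ G) :
    MI μ (fun a => F a + G a) = MI μ F + MI μ G := by
  ext i j
  exact integral_add (hF.integrable i j) (hG.integrable i j)

theorem MI_neg (F : α → Matrix k l ℝ) : MI μ (fun a => -F a) = -MI μ F := by
  ext i j
  exact integral_neg _

theorem MI_smul (c : ℝ) (F : α → Matrix k l ℝ) : MI μ (fun a => c • F a) = c • MI μ F := by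
  ext i j
  exact integral_const_mul _ _

theorem MI_transpose (F : α → Matrix k l ℝ) : (MI μ F)ᵀ = MI μ fun a => (F a)ᵀ := rfl

theorem MI_congr {F G : α → Matrix k l ℝ} (h : ∀ᵐ a ∂μ, F a = G a) : MI μ F = MI μ G := by
  ext i j
  exact integral_congr_ae (h.mono fun a ha => by simp [ha])

theorem MI_const_mul [Fintype l] (A : Matrix k l ℝ) {F : α → Matrix l m ℝ} (hF : MLp 1 μ F) :
    MI μ (fun a => A * F a) = A * MI μ F := by
  ext i j
  simp only [MI_apply, Matrix.mul_apply]
  rw [integral_finsetSum _ fun x _ => (hF.integrable x j).const_mul _]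
  simp only [integral_const_mul]

theorem MI_mul_const [Fintype l] (A : Matrix l m ℝ) {F : α → Matrix k l ℝ} (hF : MLp 1 μ F) :
    MI μ (fun a => F a * A) = MI μ F * A := by
  ext i j
  simp only [MI_apply, Matrix.mul_apply]
  rw [integral_finsetSum _ fun x _ => (hF.integrable i x).mul_const _]
  simp only [integral_mul_const]

theorem MI_swap [SFinite μ] [SFinite ν] {F : α → β → Matrix k l ℝ}
    (hF : MLp 1 (μ.prod ν) fun a => F a.1 a.2) :
    (MI μ fun a => MI ν fun b => F a b) = MI ν fun b => MI μ fun a => F a b := by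
  ext i j
  exact integral_integral_swap (hF.integrable i j)

theorem MLp.MI_one [SFinite μ] [SFinite ν] {F : α → β → Matrix k l ℝ}
    (hF : MLp 1 (μ.prod ν) fun a => F a.1 a.2) : MLp 1 μ fun a => MI ν fun b => F a b :=
  .of_integrable fun i j => (hF.integrable i j).integral_prod_left

theorem MLp.ae_right [Finite k] [Finite l] [SFinite μ] [SFinite ν] {F : α → β → Matrix k l ℝ}
    (hF : MLp 1 (μ.prod ν) fun a => F a.1 a.2) : ∀ᵐ a ∂μ, MLp 1 ν fun b => F a b := by
  have h : ∀ᵐ a ∂μ, ∀ i j, Integrable (fun b => F a b i j) ν :=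
    ae_all_iff.2 fun i => ae_all_iff.2 fun j => (hF.integrable i j).prod_right_ae
  exact h.mono fun a ha => .of_integrable ha

theorem ae_norm_le_of_memLp_top {f : α → ℝ} (hf : MemLp f ⊤ μ) : ∃ C : ℝ, ∀ᵐ a ∂μ, ‖f a‖ ≤ C := by
  refine ⟨(eLpNorm f ⊤ μ).toReal, ?_⟩
  have h := hf.2
  rw [eLpNorm_exponent_top] at h ⊢
  filter_upwards [ae_le_eLpNormEssSup (f := f) (μ := μ)] with a ha
  rw [← ENNReal.toReal_ofReal (norm_nonneg (f a)), ofReal_norm]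
  exact ENNReal.toReal_mono h.ne ha

theorem MLp.MI_top [IsFiniteMeasure μ] [IsFiniteMeasure ν] {F : α → β → Matrix k l ℝ}
    (hF : MLp ⊤ (μ.prod ν) fun a => F a.1 a.2) : MLp ⊤ μ fun a => MI ν fun b => F a b := by
  intro i j
  obtain ⟨C, hC⟩ := ae_norm_le_of_memLp_top (hF i j)
  refine memLp_top_of_bound (hF i j).1.integral_prod_right' (C * ν.real univ) ?_
  filter_upwards [Measure.ae_ae_of_ae_prod hC] with a ha
  exact norm_integral_le_of_norm_le_const ha

/-- An integral operator with essentially bounded kernel maps `L¹` to `L^∞`. -/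
theorem MLp.kernel_mul [Fintype l] [IsFiniteMeasure μ] [IsFiniteMeasure ν]
    {N : α → β → Matrix k l ℝ} {F : β → Matrix l m ℝ} (hN : MLp ⊤ (μ.prod ν) fun a => N a.1 a.2)
    (hF : MLp 1 ν F) : MLp ⊤ μ fun a => MI ν fun b => N a b * F b := by
  intro i j
  have hm : MLp 1 (μ.prod ν) fun a => N a.1 a.2 * F a.2 := hN.topMul hF.snd
  choose C hC using fun x => ae_norm_le_of_memLp_top (hN i x)
  -- The bound does not depend on `a`: entry `x` of row `i` of `N` is at most `C x`, and the entries
  -- of `F` contribute their `L¹` norms.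
  refine memLp_top_of_bound (hm i j).1.integral_prod_right' (∫ b, ∑ x, C x * ‖F b x j‖ ∂ν) ?_
  have hC' : ∀ᵐ a ∂μ, ∀ᵐ b ∂ν, ∀ x, ‖N a b i x‖ ≤ C x :=
    Measure.ae_ae_of_ae_prod (ae_all_iff.2 hC)
  filter_upwards [hC'] with a ha
  refine norm_integral_le_of_norm_le
    (integrable_finsetSum _ fun x _ => (hF.integrable x j).norm.const_mul _) ?_
  filter_upwards [ha] with b hb
  rw [Matrix.mul_apply]
  refine (norm_sum_le _ _).trans (Finset.sum_le_sum fun x _ => ?_)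
  rw [norm_mul]
  exact mul_le_mul_of_nonneg_right (hb x) (norm_nonneg _)

end calculus

/-! ### The operator with multiplier `M` and kernel `N`, and its transpose -/

section operator

variable {μ : Measure ℝ} [IsFiniteMeasure μ] {k l m r : Type*}

/-- `β ↦ M(β) F(β) + ∫ N(β, ζ) F(ζ) dζ`. -/
def PK [Fintype l] (μ : Measure ℝ) (M : ℝ → Matrix k l ℝ) (N : ℝ → ℝ → Matrix k l ℝ)
    (F : ℝ → Matrix l m ℝ) (β : ℝ) : Matrix k m ℝ := M β * F β + MI μ fun ζ => N β ζ * F ζ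

/-- `ζ ↦ E(ζ)ᵀ M(ζ) + ∫ E(β)ᵀ N(β, ζ) dβ`. -/
def PKt [Fintype k] (μ : Measure ℝ) (M : ℝ → Matrix k l ℝ) (N : ℝ → ℝ → Matrix k l ℝ)
    (E : ℝ → Matrix k m ℝ) (ζ : ℝ) : Matrix m l ℝ := (E ζ)ᵀ * M ζ + MI μ fun β => (E β)ᵀ * N β ζ

theorem MLp.PK [Fintype l] {p : ENNReal} (hp : 1 ≤ p) {M : ℝ → Matrix k l ℝ}
    {N : ℝ → ℝ → Matrix k l ℝ} {F : ℝ → Matrix l m ℝ}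
    (hM : MLp ⊤ μ M) (hN : MLp ⊤ (μ.prod μ) fun a => N a.1 a.2) (hF : MLp p μ F) :
    MLp p μ (PK μ M N F) :=
  (hM.topMul hF).add ((hN.kernel_mul (hF.mono_exponent hp)).mono_exponent le_top)

theorem MLp.PKt [Fintype k] {M : ℝ → Matrix k l ℝ} {N : ℝ → ℝ → Matrix k l ℝ} {E : ℝ → Matrix k m ℝ}
    (hM : MLp ⊤ μ M) (hN : MLp ⊤ (μ.prod μ) fun a => N a.1 a.2) (hE : MLp ⊤ μ E) :
    MLp ⊤ μ (PKt μ M N E) :=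
  (hE.transpose.topMul hM).add (MLp.MI_top (F := fun ζ β => (E β)ᵀ * N β ζ)
    (hE.transpose.snd.topMul hN.swap))

/-- Fubini. All boundedness is placed on `E`, `M` and `N`, so that `F` need only be integrable. -/
theorem MI_PK_eq_MI_PKt [Fintype k] [Fintype l] {M : ℝ → Matrix k l ℝ}
    {N : ℝ → ℝ → Matrix k l ℝ} {E : ℝ → Matrix k m ℝ}
    {F : ℝ → Matrix l r ℝ} (hM : MLp ⊤ μ M) (hN : MLp ⊤ (μ.prod μ) fun a => N a.1 a.2)
    (hE : MLp ⊤ μ E) (hF : MLp 1 μ F) [Finite m] [Finite r] :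
    MI μ (fun β => (E β)ᵀ * PK μ M N F β) = MI μ fun ζ => PKt μ M N E ζ * F ζ := by
  have hNF : MLp 1 (μ.prod μ) fun a => N a.1 a.2 * F a.2 := hN.topMul hF.snd
  have hEN : MLp ⊤ (μ.prod μ) fun a : ℝ × ℝ => (E a.1)ᵀ * N a.1 a.2 :=
    hE.transpose.fst.topMul hN
  have hENF : MLp 1 (μ.prod μ) fun a => (E a.1)ᵀ * N a.1 a.2 * F a.2 := hEN.topMul hF.snd
  have h1 : MI μ (fun β => (E β)ᵀ * PK μ M N F β)
      = MI μ (fun β => (E β)ᵀ * M β * F β)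
        + MI μ fun β => MI μ fun ζ => (E β)ᵀ * N β ζ * F ζ := by
    rw [← MI_add ((hE.transpose.topMul hM).topMul hF)
      (MLp.MI_one (F := fun β ζ => (E β)ᵀ * N β ζ * F ζ) hENF)]
    refine MI_congr ?_
    filter_upwards [MLp.ae_right (F := fun β ζ => N β ζ * F ζ) hNF] with β hβ
    rw [PK, Matrix.mul_add, ← MI_const_mul _ hβ]
    simp only [Matrix.mul_assoc]
  have h2 : MI μ (fun ζ => PKt μ M N E ζ * F ζ)
      = MI μ (fun β => (E β)ᵀ * M β * F β)
        + MI μ fun ζ => MI μ fun β => (E β)ᵀ * N β ζ * F ζ := by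
    rw [← MI_add ((hE.transpose.topMul hM).topMul hF)
      (MLp.MI_one (F := fun ζ β => (E β)ᵀ * N β ζ * F ζ) hENF.swap)]
    refine MI_congr ?_
    filter_upwards [MLp.ae_right (F := fun ζ β => (E β)ᵀ * N β ζ)
      (MLp.mono_exponent hEN.swap le_top)] with ζ hζ
    rw [PKt, Matrix.add_mul, ← MI_mul_const _ hζ]
  rw [h1, h2, MI_swap (F := fun β ζ => (E β)ᵀ * N β ζ * F ζ) hENF]

end operator

/-! ### The indicator `ind` and bounded kernels -/

theorem ind_of_nonneg {r : ℝ} (h : 0 ≤ r) : ind r = 1 := if_pos h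

theorem ind_of_neg {r : ℝ} (h : r < 0) : ind r = 0 := if_neg h.not_ge

theorem ind_mul_self (r : ℝ) : ind r * r = max r 0 := by
  unfold ind
  split_ifs with h
  · rw [one_mul, max_eq_left h]
  · rw [zero_mul, max_eq_right (le_of_not_ge h)]

theorem measurable_ind : Measurable ind :=
  Measurable.ite measurableSet_Ici measurable_const measurable_const

section carried

variable {α β : Type*} [TopologicalSpace α] [MeasurableSpace α] [TopologicalSpace β]
  [MeasurableSpace β] {μ : Measure α} {ν : Measure β}
  {k l : Type*} {p : ENNReal}

/-- The measure is concentrated on a compact set. -/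
def CompactlyCarried (μ : Measure α) : Prop := ∃ K, IsCompact K ∧ ∀ᵐ a ∂μ, a ∈ K

theorem CompactlyCarried.prod [SFinite μ] [SFinite ν] (hμ : CompactlyCarried μ)
    (hν : CompactlyCarried ν) : CompactlyCarried (μ.prod ν) := by
  obtain ⟨K, hK, h⟩ := hμ
  obtain ⟨K', hK', h'⟩ := hν
  exact ⟨K ×ˢ K', hK.prod hK', (Measure.quasiMeasurePreserving_fst.ae h).and
    (Measure.quasiMeasurePreserving_snd.ae h')⟩

theorem CompactlyCarried.memLp_top [OpensMeasurableSpace α] (hμ : CompactlyCarried μ) {f : α → ℝ}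
    (hf : Continuous f) : MemLp f ⊤ μ := by
  obtain ⟨K, hK, h⟩ := hμ
  obtain ⟨C, hC⟩ := hK.exists_bound_of_continuousOn hf.continuousOn
  exact memLp_top_of_bound hf.measurable.aestronglyMeasurable C (h.mono hC)

theorem CompactlyCarried.MLp_top [OpensMeasurableSpace α] (hμ : CompactlyCarried μ)
    {F : α → Matrix k l ℝ} (hF : Continuous F) : MLp ⊤ μ F :=
  fun i j => hμ.memLp_top (hF.matrix_elem i j)

theorem memLp_top_ind [OpensMeasurableSpace α] {f : α → ℝ} (hf : Continuous f) :
    MemLp (fun a => ind (f a)) ⊤ μ := by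
  refine memLp_top_of_bound (measurable_ind.comp hf.measurable).aestronglyMeasurable 1 ?_
  refine Filter.Eventually.of_forall fun a => ?_
  unfold ind
  split_ifs <;> simp

end carried

theorem compactlyCarried_interval (L : ℝ) : CompactlyCarried (interval L) :=
  ⟨Icc 0 L, isCompact_Icc, ae_restrict_mem measurableSet_Icc⟩

theorem ae_mem_interval (L : ℝ) : ∀ᵐ s ∂interval L, s ∈ Icc 0 L := ae_restrict_mem measurableSet_Icc

theorem ae_ne_interval (L s : ℝ) : ∀ᵐ θ ∂interval L, θ ≠ s :=
  ae_restrict_of_ae (Measure.ae_ne volume s)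

/-- Encoding the limits as indicators keeps the measure fixed, so iterated integrals with variable
limits become integrals over a product measure. -/
theorem intervalIntegral_eq_integral_interval {E : Type*} [NormedAddCommGroup E] [NormedSpace ℝ E]
    {L a b : ℝ} (ha : 0 ≤ a) (hab : a ≤ b) (hb : b ≤ L) (f : ℝ → E) :
    ∫ r in a..b, f r = ∫ r, (ind (r - a) * ind (b - r)) • f r ∂interval L := by
  rw [intervalIntegral.integral_of_le hab, ← integral_Icc_eq_integral_Ioc]
  have h : ∀ r, (ind (r - a) * ind (b - r)) • f r = (Icc a b).indicator f r := by
    intro r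
    by_cases hr : r ∈ Icc a b
    · rw [indicator_of_mem hr, ind_of_nonneg (by linarith [hr.1]),
        ind_of_nonneg (by linarith [hr.2])]
      simp
    · rw [indicator_of_notMem hr]
      by_cases h1 : a ≤ r
      · have h2 : b < r := by
          by_contra h2
          exact hr ⟨h1, not_lt.1 h2⟩
        rw [ind_of_neg (r := b - r) (by linarith)]
        simp
      · rw [ind_of_neg (r := r - a) (by linarith)]
        simp
  simp only [h]
  rw [integral_indicator measurableSet_Icc, Measure.restrict_restrict measurableSet_Icc,
    inter_eq_left.2 (Icc_subset_Icc ha hb)]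

section conversion

variable {k l : ℕ} {L : ℝ}

theorem matInt_eq_MI {a b : ℝ} (ha : 0 ≤ a) (hab : a ≤ b) (hb : b ≤ L)
    (F : ℝ → Matrix (Fin k) (Fin l) ℝ) :
    matInt a b F = MI (interval L) fun r => (ind (r - a) * ind (b - r)) • F r := by
  ext i j
  exact intervalIntegral_eq_integral_interval ha hab hb fun r => F r i j

theorem matInt_left {s : ℝ} (hs : s ∈ Icc 0 L) (F : ℝ → Matrix (Fin k) (Fin l) ℝ) :
    matInt 0 s F = MI (interval L) fun r => ind (s - r) • F r := by
  rw [matInt_eq_MI le_rfl hs.1 hs.2]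
  refine MI_congr ?_
  filter_upwards [ae_mem_interval L] with r hr
  rw [ind_of_nonneg (r := r - 0) (by linarith [hr.1]), one_mul]

theorem matInt_right {s : ℝ} (hs : s ∈ Icc 0 L) (F : ℝ → Matrix (Fin k) (Fin l) ℝ) :
    matInt s L F = MI (interval L) fun r => ind (r - s) • F r := by
  rw [matInt_eq_MI hs.1 hs.2 le_rfl]
  refine MI_congr ?_
  filter_upwards [ae_mem_interval L] with r hr
  rw [ind_of_nonneg (r := L - r) (by linarith [hr.2]), mul_one]

theorem matInt_full (hL : 0 ≤ L) (F : ℝ → Matrix (Fin k) (Fin l) ℝ) :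
    matInt 0 L F = MI (interval L) F := by
  rw [matInt_left ⟨hL, le_rfl⟩]
  refine MI_congr ?_
  filter_upwards [ae_mem_interval L] with r hr
  rw [ind_of_nonneg (by linarith [hr.2]), one_smul]

end conversion

/-- A bounded kernel on `[0, L]²` with bounded sections. -/
structure BddKernel {k l : Type*} (L : ℝ) (N : ℝ → ℝ → Matrix k l ℝ) : Prop where
  prod : MLp ⊤ ((interval L).prod (interval L)) fun a => N a.1 a.2
  right : ∀ s, MLp ⊤ (interval L) fun θ => N s θ
  left : ∀ θ, MLp ⊤ (interval L) fun s => N s θ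

/-- The kernel equal to `N₁` below and to `N₂` above the diagonal. -/
def piecewiseKernel {k l : Type*} (N₁ N₂ : ℝ → ℝ → Matrix k l ℝ) (s θ : ℝ) : Matrix k l ℝ :=
  ind (s - θ) • N₁ s θ + ind (θ - s) • N₂ s θ

section kernel

variable {k l m : Type*} {L : ℝ} {N N₁ N₂ : ℝ → ℝ → Matrix k l ℝ}

theorem BddKernel.of_continuous (hN : Continuous fun a : ℝ × ℝ => N a.1 a.2) : BddKernel L N where
  prod := ((compactlyCarried_interval L).prod (compactlyCarried_interval L)).MLp_top hN
  right s := (compactlyCarried_interval L).MLp_top (hN.comp (Continuous.prodMk_right s))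
  left θ := (compactlyCarried_interval L).MLp_top (hN.comp (Continuous.prodMk_left θ))

theorem BddKernel.add (h₁ : BddKernel L N₁) (h₂ : BddKernel L N₂) :
    BddKernel L fun s θ => N₁ s θ + N₂ s θ where
  prod := h₁.prod.add h₂.prod
  right s := (h₁.right s).add (h₂.right s)
  left θ := (h₁.left θ).add (h₂.left θ)

theorem BddKernel.ind_smul (h : BddKernel L N) {f : ℝ → ℝ → ℝ}
    (hf : Continuous fun a : ℝ × ℝ => f a.1 a.2) :
    BddKernel L fun s θ => ind (f s θ) • N s θ where
  prod := .smul_top (memLp_top_ind hf) h.prod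
  right s := .smul_top (memLp_top_ind (hf.comp (Continuous.prodMk_right s))) (h.right s)
  left θ := .smul_top (memLp_top_ind (hf.comp (Continuous.prodMk_left θ))) (h.left θ)

theorem BddKernel.piecewise (h₁ : BddKernel L N₁) (h₂ : BddKernel L N₂) :
    BddKernel L (piecewiseKernel N₁ N₂) :=
  (h₁.ind_smul (f := fun s θ => s - θ) (by fun_prop)).add
    (h₂.ind_smul (f := fun s θ => θ - s) (by fun_prop))

/-- With `θ` fixed, `A θ` is a constant matrix, so an essential bound on `A` still bounds every
section. -/
theorem BddKernel.mul_right [Fintype l] (h : BddKernel L N) {A : ℝ → Matrix l m ℝ}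
    (hA : MLp ⊤ (interval L) A) : BddKernel L fun s θ => N s θ * A θ where
  prod := h.prod.topMul hA.snd
  right s := (h.right s).topMul hA
  left θ := (h.left θ).topMul (.const (A θ))

end kernel

/-! ### Operators with a kernel split along the diagonal. -/

section pieces

variable {n k l : ℕ} {L : ℝ} {M : ℝ → Matrix (Fin n) (Fin l) ℝ}
  {N₁ N₂ : ℝ → ℝ → Matrix (Fin n) (Fin l) ℝ}

theorem PK_piecewise (h₁ : BddKernel L N₁) (h₂ : BddKernel L N₂) {F : ℝ → Matrix (Fin l) (Fin k) ℝ}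
    (hF : MLp 1 (interval L) F) {s : ℝ} (hs : s ∈ Icc 0 L) :
    M s * F s + matInt 0 s (fun θ => N₁ s θ * F θ) + matInt s L (fun θ => N₂ s θ * F θ)
      = PK (interval L) M (piecewiseKernel N₁ N₂) F s := by
  rw [matInt_left hs, matInt_right hs, add_assoc, ← MI_add, PK]
  · simp only [piecewiseKernel, Matrix.add_mul, Matrix.smul_mul]
  · exact .smul_top (memLp_top_ind (by fun_prop)) ((h₁.right s).topMul hF)
  · exact .smul_top (memLp_top_ind (by fun_prop)) ((h₂.right s).topMul hF)

theorem PKt_piecewise (h₁ : BddKernel L N₁) (h₂ : BddKernel L N₂) {E : ℝ → Matrix (Fin n) (Fin k) ℝ}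
    (hE : MLp ⊤ (interval L) E) {θ : ℝ} (hθ : θ ∈ Icc 0 L) :
    (E θ)ᵀ * M θ + matInt θ L (fun β => (E β)ᵀ * N₁ β θ) + matInt 0 θ (fun β => (E β)ᵀ * N₂ β θ)
      = PKt (interval L) M (piecewiseKernel N₁ N₂) E θ := by
  rw [matInt_left hθ, matInt_right hθ, add_assoc, ← MI_add, PKt]
  · simp only [piecewiseKernel, Matrix.mul_add, Matrix.mul_smul]
  · exact .mono_exponent (.smul_top (memLp_top_ind (by fun_prop)) (hE.transpose.topMul (h₁.left θ)))
      le_top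
  · exact .mono_exponent (.smul_top (memLp_top_ind (by fun_prop)) (hE.transpose.topMul (h₂.left θ)))
      le_top

end pieces

section linear

variable {k l m : Type*} {L : ℝ} {M : ℝ → Matrix k l ℝ}
  {N : ℝ → ℝ → Matrix k l ℝ}

theorem PK_add [Fintype l] (hN : BddKernel L N) {F₁ F₂ : ℝ → Matrix l m ℝ}
    (h₁ : MLp 1 (interval L) F₁) (h₂ : MLp 1 (interval L) F₂) (s : ℝ) :
    PK (interval L) M N (fun θ => F₁ θ + F₂ θ) s
      = PK (interval L) M N F₁ s + PK (interval L) M N F₂ s := by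
  simp only [PK, Matrix.mul_add]
  rw [MI_add ((hN.right s).topMul h₁) ((hN.right s).topMul h₂)]
  abel

theorem PKt_add [Fintype k] (hN : BddKernel L N) {E₁ E₂ : ℝ → Matrix k m ℝ}
    (h₁ : MLp 1 (interval L) E₁) (h₂ : MLp 1 (interval L) E₂) (θ : ℝ) :
    PKt (interval L) M N (fun β => E₁ β + E₂ β) θ
      = PKt (interval L) M N E₁ θ + PKt (interval L) M N E₂ θ := by
  simp only [PKt, Matrix.add_mul, Matrix.transpose_add]
  rw [MI_add (h₁.transpose.mulTop (hN.left θ)) (h₂.transpose.mulTop (hN.left θ))]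
  abel

/-- `A` depends on the variable that is not integrated. This reduces the data `Vᵢ = M Aᵢ`, `Wᵢⱼ = Nⱼ
Aᵢ` to the kernel of `(M, N₁, N₂)` itself. -/
theorem PKt_mul_right [Fintype k] [Fintype l] {r : Type*} (hN : BddKernel L N)
    {E : ℝ → Matrix k m ℝ}
    (hE : MLp 1 (interval L) E) (A : ℝ → Matrix l r ℝ) (θ : ℝ) :
    PKt (interval L) (fun s => M s * A s) (fun s θ => N s θ * A θ) E θ
      = PKt (interval L) M N E θ * A θ := by
  simp only [PKt, Matrix.add_mul, ← Matrix.mul_assoc]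
  rw [MI_mul_const _ (hE.transpose.mulTop (hN.left θ))]

end linear

/-! ### The functions `G₁` and `G₂` -/

section green

variable {n : ℕ} (L : ℝ) (B : Matrix (Fin 2 × Fin n) (Fin 4 × Fin n) ℝ)

theorem continuous_blockCol {α : Type*} [TopologicalSpace α] {k : ℕ} {c : α → Fin k → ℝ}
    (hc : Continuous c) : Continuous fun a => blockCol n (c a) :=
  continuous_matrix fun i _ => ((continuous_apply i.1).comp hc).mul continuous_const

theorem continuous_Bc : Continuous (Bc L B) := by
  have h : Continuous fun η : ℝ => (![0, L - η, 0, 1] : Fin 4 → ℝ) :=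
    continuous_pi fun i => by fin_cases i <;> simp <;> fun_prop
  exact (continuous_const.matrix_mul (continuous_const.matrix_mul (continuous_blockCol h))).neg

theorem continuous_Ba : Continuous fun a : ℝ × ℝ => Ba L B a.1 a.2 := by
  have h : Continuous fun a : ℝ × ℝ => (![1, a.1] : Fin 2 → ℝ) :=
    continuous_pi fun i => by fin_cases i <;> simp <;> fun_prop
  exact (continuous_blockCol h).matrix_transpose.matrix_mul
    ((continuous_Bc L B).comp continuous_snd)

theorem continuous_Bb : Continuous (Bb L B) := continuous_const.matrix_mul (continuous_Bc L B)

/-- The indicator multiplies a factor vanishing at its jump, leaving the continuous ramp `max (s -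
η) 0`; `G₂` keeps the jump. -/
theorem continuous_G₁ : Continuous fun a : ℝ × ℝ => G₁ L B a.1 a.2 := by
  simp only [G₁, ind_mul_self]
  exact (continuous_Ba L B).add
    (((continuous_fst.sub continuous_snd).max continuous_const).smul continuous_const)

theorem MLp_G₂ {α : Type*} [TopologicalSpace α] [MeasurableSpace α] [OpensMeasurableSpace α]
    {μ : Measure α} (hμ : CompactlyCarried μ) {f g : α → ℝ} (hf : Continuous f)
    (hg : Continuous g) : MLp ⊤ μ fun a => G₂ L B (f a) (g a) :=
  (hμ.MLp_top ((continuous_Bb L B).comp hg)).add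
    (.smul_top (memLp_top_ind (hf.sub hg)) (.const 1))

theorem bddKernel_G₁ : BddKernel L (G₁ L B) := .of_continuous (continuous_G₁ L B)

theorem bddKernel_G₂ : BddKernel L (G₂ L B) where
  prod := MLp_G₂ L B ((compactlyCarried_interval L).prod (compactlyCarried_interval L))
    continuous_fst continuous_snd
  right _ := MLp_G₂ L B (compactlyCarried_interval L) continuous_const continuous_id
  left _ := MLp_G₂ L B (compactlyCarried_interval L) continuous_id continuous_const

end green

/-! ### The kernels of `𝓛₁`, `𝓛₂`, `𝓛₃` as compositions -/

section maps

variable {n : ℕ} {L : ℝ} (B : Matrix (Fin 2 × Fin n) (Fin 4 × Fin n) ℝ)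
  {M : ℝ → Matrix (Fin n) (Fin n) ℝ} {N₁ N₂ : ℝ → ℝ → Matrix (Fin n) (Fin n) ℝ}

theorem MLp_Ba_left (η : ℝ) : MLp ⊤ (interval L) fun β => Ba L B β η :=
  (BddKernel.of_continuous (N := Ba L B) (continuous_Ba L B)).left η

theorem memLp_top_ind_mul {φ : ℝ → ℝ} (hφ : Continuous φ) (η : ℝ) :
    MemLp (fun ζ => ind (ζ - η) * φ ζ) ⊤ (interval L) :=
  ((compactlyCarried_interval L).memLp_top hφ).mul' (p := ⊤) (q := ⊤)
    (memLp_top_ind (by fun_prop))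

theorem G₁_eq (s η : ℝ) :
    G₁ L B s η = Ba L B s η + (ind (s - η) * (s - η)) • (1 : Matrix (Fin n) (Fin n) ℝ) := rfl

theorem Y₁_eq_PKt (h₁ : BddKernel L N₁) (h₂ : BddKernel L N₂) (s : ℝ) {η : ℝ} (hη : η ∈ Icc 0 L) :
    Y₁ L B M N₁ N₂ s η
      = PKt (interval L) M (piecewiseKernel N₁ N₂) (fun β => Ba L B β s) η :=
  PKt_piecewise h₁ h₂ (MLp_Ba_left B s) hη

/-- `Y₂` is the operator applied to the constant identity matrix, and a constant right factor passes
through the integrals. -/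
theorem Y₂_mul_eq_PK (h₁ : BddKernel L N₁) (h₂ : BddKernel L N₂) (A : Matrix (Fin n) (Fin n) ℝ)
    {ζ : ℝ} (hζ : ζ ∈ Icc 0 L) :
    Y₂ L M N₁ N₂ ζ * A = PK (interval L) M (piecewiseKernel N₁ N₂) (fun _ => A) ζ := by
  have h := PK_piecewise (M := M) h₁ h₂ (F := fun _ => (1 : Matrix (Fin n) (Fin n) ℝ))
    (MLp.mono_exponent (.const 1) le_top) hζ
  simp only [Matrix.mul_one] at h
  rw [Y₂, h, PK, PK, Matrix.add_mul, ← MI_mul_const]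
  · simp only [Matrix.mul_one]
  · exact ((h₁.piecewise h₂).right ζ).topMul (MLp.mono_exponent (.const 1) le_top)

theorem Y₃_eq_PK (h₁ : BddKernel L N₁) (h₂ : BddKernel L N₂) {ζ : ℝ} (hζ : ζ ∈ Icc 0 L) (η : ℝ) :
    Y₃ L B M N₁ N₂ ζ η
      = PK (interval L) M (piecewiseKernel N₁ N₂) (fun θ => Ba L B θ η) ζ :=
  PK_piecewise h₁ h₂ (MLp.mono_exponent (MLp_Ba_left B η) le_top) hζ

/-- The boundary part of `G₁` yields `Y₁`, so only the ramp remains to be matched with `kerE₁` and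
`kerE₂`. -/
theorem PKt_G₁ (h₁ : BddKernel L N₁) (h₂ : BddKernel L N₂) (s : ℝ) {θ : ℝ} (hθ : θ ∈ Icc 0 L) :
    PKt (interval L) M (piecewiseKernel N₁ N₂) (fun β => G₁ L B β s) θ
      = PKt (interval L) M (piecewiseKernel N₁ N₂)
          (fun β => (ind (β - s) * (β - s)) • (1 : Matrix (Fin n) (Fin n) ℝ)) θ
        + Y₁ L B M N₁ N₂ s θ := by
  rw [Y₁_eq_PKt B h₁ h₂ s hθ, add_comm]
  exact PKt_add (h₁.piecewise h₂) (MLp.mono_exponent (MLp_Ba_left B s) le_top)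
    (MLp.mono_exponent (.smul_top (memLp_top_ind_mul (by fun_prop) s) (.const 1)) le_top) θ

theorem map₁_fst (h₁ : BddKernel L N₁) (h₂ : BddKernel L N₂) {s θ : ℝ} (hs : s ∈ Icc 0 L)
    (hθ : θ ∈ Icc 0 L) (h : θ < s) :
    (map₁ L B M N₁ N₂).1 s θ
      = PKt (interval L) M (piecewiseKernel N₁ N₂) (fun β => G₁ L B β s) θ := by
  rw [PKt_G₁ B h₁ h₂ s hθ]
  refine congrArg (· + _) ?_
  simp only [PKt, kerE₁, Matrix.transpose_smul, Matrix.transpose_one, Matrix.smul_mul,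
    Matrix.one_mul]
  -- Below the diagonal the ramp at `θ` vanishes, which removes the multiplier term; and `β ≥ s > θ`
  -- leaves only the `N₁` branch of the kernel.
  rw [matInt_right hs, ind_of_neg (r := θ - s) (by linarith), zero_mul, zero_smul, zero_add]
  refine MI_congr (Filter.Eventually.of_forall fun β => ?_)
  dsimp only [piecewiseKernel]
  rcases lt_or_ge β s with hβ | hβ
  · simp [ind_of_neg (r := β - s) (by linarith)]
  · rw [ind_of_nonneg (r := β - s) (by linarith), ind_of_nonneg (r := β - θ) (by linarith),
      ind_of_neg (r := θ - β) (by linarith)]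
    simp

theorem map₁_snd (h₁ : BddKernel L N₁) (h₂ : BddKernel L N₂) {s θ : ℝ} (hs : s ∈ Icc 0 L)
    (hθ : θ ∈ Icc 0 L) (h : s < θ) :
    (map₁ L B M N₁ N₂).2 s θ
      = PKt (interval L) M (piecewiseKernel N₁ N₂) (fun β => G₁ L B β s) θ := by
  rw [PKt_G₁ B h₁ h₂ s hθ]
  refine congrArg (· + _) ?_
  have hc : MemLp (fun η : ℝ => η - s) ⊤ (interval L) :=
    (compactlyCarried_interval L).memLp_top (by fun_prop)
  simp only [PKt, kerE₂, Matrix.transpose_smul, Matrix.transpose_one, Matrix.smul_mul,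
    Matrix.one_mul]
  rw [matInt_right hθ, matInt_eq_MI hs.1 h.le hθ.2, ind_of_nonneg (r := θ - s) (by linarith),
    one_mul, add_assoc, ← MI_add]
  -- Above the diagonal the range `β ≥ s` is cut at `θ`: `N₂` acts on `[s, θ]` and `N₁` on `[θ, L]`.
  · refine congrArg _ (MI_congr (Filter.Eventually.of_forall fun β => ?_))
    dsimp only [piecewiseKernel]
    rcases lt_or_ge β s with hβ | hβ
    · simp [ind_of_neg (r := β - s) (by linarith), ind_of_neg (r := β - θ) (by linarith)]
    · rw [ind_of_nonneg (r := β - s) (by linarith)]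
      simp only [smul_add, smul_smul, one_mul]
      rw [mul_comm (ind (β - θ)), mul_comm (ind (θ - β))]
  · exact .mono_exponent (.smul_top (memLp_top_ind (by fun_prop)) (.smul_top hc (h₁.left θ))) le_top
  · refine .mono_exponent (.smul_top (MemLp.mul' (p := ⊤) (q := ⊤) ?_ ?_)
      (.smul_top hc (h₂.left θ))) le_top
    · exact memLp_top_ind (by fun_prop)
    · exact memLp_top_ind (by fun_prop)

/-- The ramp-against-step term of the expansion. The outer variable is chosen to be the larger one
in both the `N₁` and the `N₂` part; it then lies above both `s` and `η`, which produces the lower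
limit `max s η`. -/
theorem MI_smul_PK_smul (hM : MLp ⊤ (interval L) M) (h₁ : BddKernel L N₁) (h₂ : BddKernel L N₂)
    {s η : ℝ} (hs : s ∈ Icc 0 L) (hη : η ∈ Icc 0 L) {φ : ℝ → ℝ} (hφ : Continuous φ) :
    MI (interval L) (fun β => (ind (β - s) * (β - s)) • PK (interval L) M (piecewiseKernel N₁ N₂)
        (fun ζ => (ind (ζ - η) * φ ζ) • (1 : Matrix (Fin n) (Fin n) ℝ)) β)
      = matInt (max s η) L fun β =>
          (β - s) • (φ β • M β + matInt η β (fun ζ => φ ζ • N₁ β ζ))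
            + matInt s β (fun ζ => ((ζ - s) * φ β) • N₂ ζ β) := by
  have hg : MemLp (fun β => ind (β - s) * (β - s)) ⊤ (interval L) :=
    memLp_top_ind_mul (by fun_prop) s
  have hh : MemLp (fun ζ => ind (ζ - η) * φ ζ) ⊤ (interval L) := memLp_top_ind_mul hφ η
  have k₁ := h₁.ind_smul (f := fun s θ => s - θ) (by fun_prop)
  have k₂ := h₂.ind_smul (f := fun s θ => θ - s) (by fun_prop)
  have hgh : MemLp (fun a : ℝ × ℝ => (ind (a.1 - s) * (a.1 - s)) * (ind (a.2 - η) * φ a.2)) ⊤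
      ((interval L).prod (interval L)) :=
    (hh.comp_snd (interval L)).mul' (p := ⊤) (q := ⊤) (hg.comp_fst (interval L))
  have i₁ : MLp ⊤ ((interval L).prod (interval L)) fun a : ℝ × ℝ =>
      ((ind (a.1 - s) * (a.1 - s)) * (ind (a.2 - η) * φ a.2)) • ind (a.1 - a.2) • N₁ a.1 a.2 :=
    .smul_top hgh k₁.prod
  have i₂ : MLp ⊤ ((interval L).prod (interval L)) fun a : ℝ × ℝ =>
      ((ind (a.1 - s) * (a.1 - s)) * (ind (a.2 - η) * φ a.2)) • ind (a.2 - a.1) • N₂ a.1 a.2 :=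
    .smul_top hgh k₂.prod
  have i₀ : MLp 1 (interval L) fun β =>
      ((ind (β - s) * (β - s)) * (ind (β - η) * φ β)) • M β :=
    .mono_exponent (.smul_top (hh.mul' (p := ⊤) (q := ⊤) hg) hM) le_top
  have e₁ : ∀ β, (ind (β - s) * (β - s)) • PK (interval L) M (piecewiseKernel N₁ N₂)
        (fun ζ => (ind (ζ - η) * φ ζ) • (1 : Matrix (Fin n) (Fin n) ℝ)) β
      = ((ind (β - s) * (β - s)) * (ind (β - η) * φ β)) • M β
        + ((MI (interval L) fun ζ =>
            ((ind (β - s) * (β - s)) * (ind (ζ - η) * φ ζ)) • ind (β - ζ) • N₁ β ζ)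
          + MI (interval L) fun ζ =>
            ((ind (β - s) * (β - s)) * (ind (ζ - η) * φ ζ)) • ind (ζ - β) • N₂ β ζ) := by
    intro β
    rw [← MI_add]
    · simp only [PK, smul_add, Matrix.mul_smul, Matrix.mul_one, ← MI_smul, smul_smul,
        piecewiseKernel, mul_assoc]
    · exact .mono_exponent (.smul_top (hh.const_mul _) (k₁.right β)) le_top
    · exact .mono_exponent (.smul_top (hh.const_mul _) (k₂.right β)) le_top
  have hm : max s η ∈ Icc 0 L := ⟨le_max_of_le_left hs.1, max_le hs.2 hη.2⟩
  simp only [e₁]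
  have a₁ := MLp.MI_one (F := fun β ζ =>
      ((ind (β - s) * (β - s)) * (ind (ζ - η) * φ ζ)) • ind (β - ζ) • N₁ β ζ)
      (i₁.mono_exponent le_top)
  have a₂ := MLp.MI_one (F := fun β ζ =>
      ((ind (β - s) * (β - s)) * (ind (ζ - η) * φ ζ)) • ind (ζ - β) • N₂ β ζ)
      (i₂.mono_exponent le_top)
  have a₃ := MLp.MI_one (F := fun ζ β =>
      ((ind (β - s) * (β - s)) * (ind (ζ - η) * φ ζ)) • ind (ζ - β) • N₂ β ζ)
      (i₂.swap.mono_exponent le_top)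
  -- Only the `N₂` term is swapped: there the integration variable of the operator is the larger one
  -- and has to become the outer one.
  rw [MI_add i₀ (a₁.add a₂), MI_add a₁ a₂, MI_swap (F := fun β ζ =>
      ((ind (β - s) * (β - s)) * (ind (ζ - η) * φ ζ)) • ind (ζ - β) • N₂ β ζ)
      (i₂.mono_exponent le_top), ← MI_add a₁ a₃, ← MI_add i₀ (a₁.add a₃), matInt_right hm]
  · refine MI_congr ?_
    filter_upwards [ae_mem_interval L] with β hβ
    rcases lt_or_ge β (max s η) with hlt | hge
    · rw [ind_of_neg (r := β - max s η) (by linarith), zero_smul]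
      -- Below `max s η` each of the three integrands contains a vanishing indicator, since the
      -- inner variable is at most `β`.
      have z₀ : ((ind (β - s) * (β - s)) * (ind (β - η) * φ β)) = 0 := by
        rcases lt_max_iff.1 hlt with h | h
        · simp [ind_of_neg (r := β - s) (by linarith)]
        · simp [ind_of_neg (r := β - η) (by linarith)]
      have z₁ : ∀ ζ, ((ind (β - s) * (β - s)) * (ind (ζ - η) * φ ζ)) • ind (β - ζ) • N₁ β ζ
          = 0 := by
        intro ζ
        rcases lt_max_iff.1 hlt with h | h
        · simp [ind_of_neg (r := β - s) (by linarith)]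
        · rcases lt_or_ge ζ η with h' | h'
          · simp [ind_of_neg (r := ζ - η) (by linarith)]
          · simp [ind_of_neg (r := β - ζ) (by linarith)]
      have z₂ : ∀ ζ, ((ind (ζ - s) * (ζ - s)) * (ind (β - η) * φ β)) • ind (β - ζ) • N₂ ζ β
          = 0 := by
        intro ζ
        rcases lt_max_iff.1 hlt with h | h
        · rcases lt_or_ge ζ s with h' | h'
          · simp [ind_of_neg (r := ζ - s) (by linarith)]
          · simp [ind_of_neg (r := β - ζ) (by linarith)]
        · simp [ind_of_neg (r := β - η) (by linarith)]
      simp only [z₀, z₁, z₂, zero_smul, zero_add]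
      ext i j
      simp [MI_apply]
    · have hs' : s ≤ β := (le_max_left _ _).trans hge
      have hη' : η ≤ β := (le_max_right _ _).trans hge
      rw [ind_of_nonneg (r := β - max s η) (by linarith), one_smul,
        ind_of_nonneg (r := β - s) (by linarith), ind_of_nonneg (r := β - η) (by linarith),
        matInt_eq_MI hη.1 hη' hβ.2, matInt_eq_MI hs.1 hs' hβ.2, smul_add, smul_smul, ← MI_smul,
        add_assoc]
      simp only [smul_smul, one_mul]
      refine congrArg₂ _ rfl (congrArg₂ _ ?_ ?_)
      · refine congrArg _ (funext fun ζ => congrArg₂ _ ?_ rfl)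
        ring
      · refine congrArg _ (funext fun ζ => congrArg₂ _ ?_ rfl)
        ring

/-- Four-term expansion of (boundary + ramp) against (`E` + step). A general weight `φ` serves both
maps: `φ = 1` with `E = Bb` gives `G₂` for `𝓛₂`, and `φ(ζ) = ζ - η` with `E = Ba` gives `G₁` for
`𝓛₃`. The three terms containing a boundary part make up `kerF₃` or `kerG₃`. -/
theorem MI_G₁_PK (hM : MLp ⊤ (interval L) M) (h₁ : BddKernel L N₁) (h₂ : BddKernel L N₂)
    {s η : ℝ} (hs : s ∈ Icc 0 L) (hη : η ∈ Icc 0 L) {φ : ℝ → ℝ} (hφ : Continuous φ)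
    {E : ℝ → Matrix (Fin n) (Fin n) ℝ} (hE : MLp ⊤ (interval L) E) :
    MI (interval L) (fun β => (G₁ L B β s)ᵀ * PK (interval L) M (piecewiseKernel N₁ N₂)
        (fun ζ => E ζ + (ind (ζ - η) * φ ζ) • (1 : Matrix (Fin n) (Fin n) ℝ)) β)
      = (matInt (max s η) L fun β =>
          (β - s) • (φ β • M β + matInt η β (fun ζ => φ ζ • N₁ β ζ))
            + matInt s β (fun ζ => ((ζ - s) * φ β) • N₂ ζ β))
        + (matInt 0 L (fun β => (Ba L B β s)ᵀ * PK (interval L) M (piecewiseKernel N₁ N₂) E β)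
          + matInt η L (fun ζ => φ ζ • Y₁ L B M N₁ N₂ s ζ)
          + matInt s L fun β => (β - s) • PK (interval L) M (piecewiseKernel N₁ N₂) E β) := by
  have hN := h₁.piecewise h₂
  have hg : MemLp (fun β => ind (β - s) * (β - s)) ⊤ (interval L) :=
    memLp_top_ind_mul (by fun_prop) s
  have hh : MemLp (fun ζ => ind (ζ - η) * φ ζ) ⊤ (interval L) := memLp_top_ind_mul hφ η
  have hH : MLp 1 (interval L) fun ζ =>
      (ind (ζ - η) * φ ζ) • (1 : Matrix (Fin n) (Fin n) ℝ) :=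
    .mono_exponent (.smul_top hh (.const 1)) le_top
  have hE1 : MLp 1 (interval L) E := hE.mono_exponent le_top
  have pE := MLp.PK le_rfl hM hN.prod hE1
  have pH := MLp.PK le_rfl hM hN.prod hH
  have hBa := (MLp_Ba_left (L := L) B s)
  have e : ∀ β, (G₁ L B β s)ᵀ * PK (interval L) M (piecewiseKernel N₁ N₂)
        (fun ζ => E ζ + (ind (ζ - η) * φ ζ) • (1 : Matrix (Fin n) (Fin n) ℝ)) β
      = (ind (β - s) * (β - s)) • PK (interval L) M (piecewiseKernel N₁ N₂)
          (fun ζ => (ind (ζ - η) * φ ζ) • (1 : Matrix (Fin n) (Fin n) ℝ)) β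
        + ((Ba L B β s)ᵀ * PK (interval L) M (piecewiseKernel N₁ N₂) E β
          + (Ba L B β s)ᵀ * PK (interval L) M (piecewiseKernel N₁ N₂)
          (fun ζ => (ind (ζ - η) * φ ζ) • (1 : Matrix (Fin n) (Fin n) ℝ)) β
          + (ind (β - s) * (β - s)) • PK (interval L) M (piecewiseKernel N₁ N₂) E β) := by
    intro β
    rw [PK_add hN hE1 hH]
    simp only [G₁_eq, Matrix.transpose_add, Matrix.transpose_smul, Matrix.transpose_one,
      Matrix.add_mul, Matrix.mul_add, Matrix.smul_mul, Matrix.one_mul]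
    abel
  simp only [e]
  have i₁ := hBa.transpose.topMul pE
  have i₂ := hBa.transpose.topMul pH
  have i₃ : MLp 1 (interval L) fun β => (ind (β - s) * (β - s)) •
    PK (interval L) M (piecewiseKernel N₁ N₂) E β := .smul_top hg pE
  rw [MI_add (.smul_top hg pH) ((i₁.add i₂).add i₃), MI_add (i₁.add i₂) i₃, MI_add i₁ i₂,
    MI_smul_PK_smul hM h₁ h₂ hs hη hφ, MI_PK_eq_MI_PKt hM hN.prod hBa hH,
    matInt_full (hs.1.trans hs.2), matInt_right hη, matInt_right hs]
  refine congrArg _ (congrArg₂ _ (congrArg _ (MI_congr ?_)) (MI_congr ?_))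
  · filter_upwards [ae_mem_interval L] with ζ hζ
    rw [Y₁_eq_PKt B h₁ h₂ s hζ, Matrix.mul_smul, Matrix.mul_one, smul_smul]
  · filter_upwards with β
    rw [smul_smul]

theorem kerF₃_eq (hM : MLp ⊤ (interval L) M) (h₁ : BddKernel L N₁) (h₂ : BddKernel L N₂)
    {s : ℝ} (hs : s ∈ Icc 0 L) (η : ℝ) :
    kerF₃ L B M N₁ N₂ s η
      = matInt 0 L (fun β => (Ba L B β s)ᵀ
            * PK (interval L) M (piecewiseKernel N₁ N₂) (fun _ => Bb L B η) β)
        + matInt η L (fun ζ => Y₁ L B M N₁ N₂ s ζ)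
        + matInt s L fun β => (β - s) •
            PK (interval L) M (piecewiseKernel N₁ N₂) (fun _ => Bb L B η) β := by
  have hL := hs.1.trans hs.2
  have hY : MLp 1 (interval L) (Y₂ L M N₁ N₂) := by
    refine (MLp.PK le_rfl hM (h₁.piecewise h₂).prod
      (MLp.mono_exponent (.const (1 : Matrix (Fin n) (Fin n) ℝ)) le_top)).congr ?_
    filter_upwards [ae_mem_interval L] with ζ hζ
    rw [← Y₂_mul_eq_PK h₁ h₂ 1 hζ, Matrix.mul_one]
  rw [kerF₃, matInt_full hL, matInt_full hL, matInt_right hs, matInt_right hs, ← MI_mul_const]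
  · refine congrArg₂ _ (congrArg₂ _ (MI_congr ?_) rfl) (MI_congr ?_)
    · filter_upwards [ae_mem_interval L] with ζ hζ
      rw [Matrix.mul_assoc, Y₂_mul_eq_PK h₁ h₂ _ hζ]
    · filter_upwards [ae_mem_interval L] with ζ hζ
      rw [Matrix.smul_mul, Matrix.smul_mul, Y₂_mul_eq_PK h₁ h₂ _ hζ]
  · exact .smul_top (memLp_top_ind (by fun_prop)) (.smul_top
      ((compactlyCarried_interval L).memLp_top (by fun_prop)) hY)

theorem kerG₃_eq (h₁ : BddKernel L N₁) (h₂ : BddKernel L N₂)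
    {s : ℝ} (hs : s ∈ Icc 0 L) (η : ℝ) :
    kerG₃ L B M N₁ N₂ s η
      = matInt 0 L (fun β => (Ba L B β s)ᵀ
            * PK (interval L) M (piecewiseKernel N₁ N₂) (fun ζ => Ba L B ζ η) β)
        + matInt η L (fun ζ => (ζ - η) • Y₁ L B M N₁ N₂ s ζ)
        + matInt s L fun β => (β - s) •
            PK (interval L) M (piecewiseKernel N₁ N₂) (fun ζ => Ba L B ζ η) β := by
  have hL := hs.1.trans hs.2
  rw [kerG₃, matInt_full hL, matInt_full hL, matInt_right hs, matInt_right hs]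
  refine congrArg₂ _ (congrArg₂ _ (MI_congr ?_) rfl) (MI_congr ?_) <;>
  · filter_upwards [ae_mem_interval L] with ζ hζ
    rw [Y₃_eq_PK B h₁ h₂ hζ]

theorem map₂_eq_aux (hM : MLp ⊤ (interval L) M) (h₁ : BddKernel L N₁) (h₂ : BddKernel L N₂)
    {s η : ℝ} (hs : s ∈ Icc 0 L) (hη : η ∈ Icc 0 L) :
    (matInt (max s η) L fun β => (β - s) • kerF₄ M N₁ η β + kerF₅ N₂ s β)
        + kerF₃ L B M N₁ N₂ s η
      = MI (interval L) fun β => (G₁ L B β s)ᵀ * PK (interval L) M (piecewiseKernel N₁ N₂)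
        (fun ζ => G₂ L B ζ η) β := by
  rw [kerF₃_eq B hM h₁ h₂ hs]
  have h := MI_G₁_PK B hM h₁ h₂ hs hη (φ := fun _ => 1) continuous_const (E := fun _ => Bb L B η)
    (.const _)
  simp only [mul_one, one_smul] at h
  exact h.symm

theorem map₃_eq_aux (hM : MLp ⊤ (interval L) M) (h₁ : BddKernel L N₁) (h₂ : BddKernel L N₂)
    {s η : ℝ} (hs : s ∈ Icc 0 L) (hη : η ∈ Icc 0 L) :
    (matInt (max s η) L fun β => (β - s) • kerG₄ M N₁ η β + kerG₅ N₂ s η β)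
        + kerG₃ L B M N₁ N₂ s η
      = MI (interval L) fun β => (G₁ L B β s)ᵀ * PK (interval L) M (piecewiseKernel N₁ N₂)
        (fun ζ => G₁ L B ζ η) β := by
  rw [kerG₃_eq B h₁ h₂ hs]
  exact (MI_G₁_PK B hM h₁ h₂ hs hη (φ := fun ζ => ζ - η) (by fun_prop) (E := fun ζ => Ba L B ζ η)
    (MLp_Ba_left B η)).symm

end maps

/-! ### Vectors as columns -/

section columns

variable {k l : ℕ} {α : Type*} [MeasurableSpace α] {μ : Measure α} {p : ENNReal}

/-- A vector as a one-column matrix. -/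
def colVec (v : Vec k) : Matrix (Fin k) (Fin 1) ℝ := Matrix.of fun i _ => v i

theorem colVec_apply (v : Vec k) (i : Fin k) (j : Fin 1) : colVec v i j = v i := rfl

theorem colVec_injective : Function.Injective (colVec (k := k)) := fun v w h => by
  ext i
  exact congrFun (congrFun h i) 0

theorem colVec_add (v w : Vec k) : colVec (v + w) = colVec v + colVec w := rfl

theorem colVec_smul (c : ℝ) (v : Vec k) : colVec (c • v) = c • colVec v := rfl

theorem colVec_mv (A : Matrix (Fin k) (Fin l) ℝ) (v : Vec l) : colVec (mv A v) = A * colVec v := by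
  ext i j
  simp [colVec, mv, Matrix.mul_apply, Matrix.mulVec, dotProduct]

theorem inner_eq_colVec (v w : Vec k) : inner ℝ v w = ((colVec v)ᵀ * colVec w) 0 0 := by
  simp [colVec, PiLp.inner_apply, Matrix.mul_apply, mul_comm]

theorem MLp_colVec {f : α → Vec k} : (MLp p μ fun a => colVec (f a)) ↔ MemLp f p μ := by
  rw [memLp_piLp_iff]
  exact ⟨fun h i => h i 0, fun h i _ => h i⟩

theorem colVec_integral {f : α → Vec k} (hf : Integrable f μ) :
    colVec (∫ a, f a ∂μ) = MI μ fun a => colVec (f a) := by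
  ext i j
  exact eval_integral_piLp
    (fun i => (MLp_colVec.2 (memLp_one_iff_integrable.2 hf)).integrable i 0) i

theorem colVec_intervalIntegral {L a b : ℝ} (ha : 0 ≤ a) (hab : a ≤ b) (hb : b ≤ L) {f : ℝ → Vec k}
    (hf : MemLp f 1 (interval L)) :
    colVec (∫ r in a..b, f r) = matInt a b fun r => colVec (f r) := by
  rw [intervalIntegral_eq_integral_interval ha hab hb, matInt_eq_MI ha hab hb, colVec_integral]
  · simp only [colVec_smul]
  · rw [← memLp_one_iff_integrable, ← MLp_colVec]
    simp only [colVec_smul]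
    refine .smul_top (MemLp.mul' (p := ⊤) (q := ⊤) ?_ ?_) (MLp_colVec.2 hf) <;>
    exact memLp_top_ind (by fun_prop)

theorem MLp_colVec_mv_iff {A : α → Matrix (Fin k) (Fin l) ℝ} {f : α → Vec l} :
    MemLp (fun a => mv (A a) (f a)) p μ ↔ MLp p μ fun a => A a * colVec (f a) := by
  rw [← MLp_colVec]
  simp only [colVec_mv]

theorem ip_eq_MI {L : ℝ} (hL : 0 ≤ L) (f g : ℝ → Vec k) :
    ip L f g = MI (interval L) (fun s => (colVec (f s))ᵀ * colVec (g s)) 0 0 := by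
  rw [ip, intervalIntegral.integral_of_le hL, ← integral_Icc_eq_integral_Ioc]
  simp only [inner_eq_colVec]
  rfl

theorem colVec_opP {n : ℕ} {L : ℝ} {M : ℝ → Matrix (Fin n) (Fin n) ℝ}
    {N₁ N₂ : ℝ → ℝ → Matrix (Fin n) (Fin n) ℝ} (h₁ : BddKernel L N₁) (h₂ : BddKernel L N₂)
    {x : ℝ → Vec n} (hx : MemLp x 1 (interval L)) {s : ℝ} (hs : s ∈ Icc 0 L) :
    colVec (opP L M N₁ N₂ x s)
      = PK (interval L) M (piecewiseKernel N₁ N₂) (fun θ => colVec (x θ)) s := by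
  have hX := MLp_colVec.2 hx
  rw [← PK_piecewise h₁ h₂ hX hs, opP, colVec_add, colVec_add, colVec_mv,
    colVec_intervalIntegral le_rfl hs.1 hs.2, colVec_intervalIntegral hs.1 hs.2 le_rfl]
  · simp only [colVec_mv]
  · exact MLp_colVec_mv_iff.2 ((h₂.right s).topMul hX)
  · exact MLp_colVec_mv_iff.2 ((h₁.right s).topMul hX)

end columns

/-! ### Representation of `u`, `u_s` and the boundary values through `u_ss` -/

section representation

variable {n : ℕ} {L : ℝ}

theorem MI_smul_const {α k l : Type*} [MeasurableSpace α] {μ : Measure α} (c : α → ℝ)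
    (A : Matrix k l ℝ) : MI μ (fun a => c a • A) = (∫ a, c a ∂μ) • A := by
  ext i j
  exact integral_mul_const _ _

theorem blockCol_mul_apply {k r : ℕ} (c : Fin k → ℝ) (A : Matrix (Fin n) (Fin r) ℝ)
    (i : Fin k × Fin n) (j : Fin r) : (blockCol n c * A) i j = c i.1 * A i.2 j := by
  simp [blockCol, Matrix.mul_apply, Matrix.one_apply]

/-- The length of `[η, s]`, or zero when `s < η`: this is the ramp in the remainder of Taylor's
formula. -/
theorem integral_ind_mul_ind {s η : ℝ} (hs : s ∈ Icc 0 L) (hη : η ∈ Icc 0 L) :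
    ∫ r, ind (s - r) * ind (r - η) ∂interval L = ind (s - η) * (s - η) := by
  rcases le_or_gt η s with h | h
  · have := intervalIntegral_eq_integral_interval (L := L) hη.1 h hs.2 fun _ => (1 : ℝ)
    simp only [intervalIntegral.integral_const, smul_eq_mul, mul_one] at this
    rw [ind_of_nonneg (by linarith), one_mul, this]
    simp only [mul_comm]
  · rw [ind_of_neg (r := s - η) (by linarith), zero_mul]
    refine integral_eq_zero_of_ae (Filter.Eventually.of_forall fun r => ?_)
    rcases le_or_gt r s with hr | hr
    · simp [ind_of_neg (r := r - η) (by linarith)]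
    · simp [ind_of_neg (r := s - r) (by linarith)]

variable {u us uss : ℝ → Vec n}

theorem IsW2.colVec_us (hu : IsW2 L u us uss) {s : ℝ} (hs : s ∈ Icc 0 L) :
    colVec (us s)
      = colVec (us 0) + MI (interval L) fun η => ind (s - η) • colVec (uss η) := by
  rw [hu.deriv₂ s hs, colVec_add, colVec_intervalIntegral le_rfl hs.1 hs.2
    (hu.memLp.mono_exponent one_le_two), matInt_left hs]

/-- Taylor's formula with integral remainder: the double primitive of `uss` collapses to a single
integral by Fubini. -/
theorem IsW2.colVec_u (hu : IsW2 L u us uss) {s : ℝ} (hs : s ∈ Icc 0 L) :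
    colVec (u s) = colVec (u 0) + s • colVec (us 0)
      + MI (interval L) fun η => (ind (s - η) * (s - η)) • colVec (uss η) := by
  have hZ : MLp 1 (interval L) fun η => colVec (uss η) :=
    MLp_colVec.2 (hu.memLp.mono_exponent one_le_two)
  have hp : MLp 1 ((interval L).prod (interval L)) fun a : ℝ × ℝ =>
      ind (a.1 - a.2) • colVec (uss a.2) := .smul_top (memLp_top_ind (by fun_prop)) hZ.snd
  have hp' : MLp 1 ((interval L).prod (interval L)) fun a : ℝ × ℝ =>
      ind (s - a.1) • ind (a.1 - a.2) • colVec (uss a.2) :=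
    .smul_top (memLp_top_ind (by fun_prop)) hp
  -- `IsW2` does not list integrability of `us`; it follows from its representation as a primitive
  -- of `uss`.
  have hus : MemLp us 1 (interval L) := by
    rw [← MLp_colVec]
    refine (MLp.add (MLp.mono_exponent (.const (colVec (us 0))) le_top)
      (MLp.MI_one (F := fun s η => ind (s - η) • colVec (uss η)) hp)).congr ?_
    filter_upwards [ae_mem_interval L] with r hr
    rw [hu.colVec_us hr]
  rw [hu.deriv₁ s hs, colVec_add, colVec_intervalIntegral le_rfl hs.1 hs.2 hus, matInt_left hs,
    add_assoc]
  have e : MI (interval L) (fun r => ind (s - r) • colVec (us r))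
      = MI (interval L) fun r => ind (s - r) • colVec (us 0)
        + MI (interval L) fun η => ind (s - r) • ind (r - η) • colVec (uss η) := by
    refine MI_congr ?_
    filter_upwards [ae_mem_interval L] with r hr
    rw [hu.colVec_us hr, smul_add, MI_smul]
  rw [e, MI_add, MI_smul_const,
    MI_swap (F := fun r η => ind (s - r) • ind (r - η) • colVec (uss η)) hp']
  · have h0 := intervalIntegral_eq_integral_interval (L := L) le_rfl hs.1 hs.2 fun _ => (1 : ℝ)
    simp only [intervalIntegral.integral_const, smul_eq_mul, mul_one, sub_zero] at h0
    refine congrArg _ (congrArg₂ _ (congrArg₂ _ ?_ rfl) (MI_congr ?_))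
    · refine Eq.trans (integral_congr_ae ?_) h0.symm
      filter_upwards [ae_mem_interval L] with r hr
      rw [ind_of_nonneg hr.1, one_mul]
    · filter_upwards [ae_mem_interval L] with η hη
      simp only [smul_smul]
      rw [MI_smul_const, integral_ind_mul_ind hs hη]
  · exact .mono_exponent (.smul_top (memLp_top_ind (by fun_prop)) (.const _)) le_top
  · exact MLp.MI_one (F := fun r η => ind (s - r) • ind (r - η) • colVec (uss η)) hp'

/-- The stacked vector of boundary values as a column. -/
def bdryCol (L : ℝ) (u us : ℝ → Vec n) : Matrix (Fin 4 × Fin n) (Fin 1) ℝ :=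
  Matrix.of fun p _ => bdryVec L u us p

/-- The stacked vector `(u(0), u_s(0))` as a column. -/
def initCol (u us : ℝ → Vec n) : Matrix (Fin 2 × Fin n) (Fin 1) ℝ :=
  Matrix.of fun p _ => (![u 0, us 0] p.1).ofLp p.2

theorem IsW2.bdryCol_eq (hu : IsW2 L u us uss) (hL : 0 ≤ L) :
    bdryCol L u us = bdryMat n L * initCol u us
      + MI (interval L) fun η => blockCol n ![0, L - η, 0, 1] * colVec (uss η) := by
  have hu1 := hu.colVec_u (s := L) ⟨hL, le_rfl⟩
  have hu2 := hu.colVec_us (s := L) ⟨hL, le_rfl⟩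
  have e1 : MI (interval L) (fun η => (ind (L - η) * (L - η)) • colVec (uss η))
      = MI (interval L) (fun η => (L - η) • colVec (uss η)) := by
    refine MI_congr ?_
    filter_upwards [ae_mem_interval L] with η hη
    rw [ind_of_nonneg (by linarith [hη.2]), one_mul]
  have e2 : MI (interval L) (fun η => ind (L - η) • colVec (uss η))
      = MI (interval L) (fun η => colVec (uss η)) := by
    refine MI_congr ?_
    filter_upwards [ae_mem_interval L] with η hη
    rw [ind_of_nonneg (by linarith [hη.2]), one_smul]
  rw [e1] at hu1
  rw [e2] at hu2
  ext ⟨p, i⟩ j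
  have h1 := congrFun (congrFun hu1 i) j
  have h2 := congrFun (congrFun hu2 i) j
  simp only [Matrix.add_apply, Matrix.smul_apply, MI_apply, colVec_apply, smul_eq_mul] at h1 h2
  rw [Matrix.add_apply, MI_apply]
  simp only [blockCol_mul_apply, colVec_apply]
  fin_cases p <;>
    simp [bdryCol, bdryVec, initCol, bdryMat, Matrix.mul_apply, Fintype.sum_prod_type,
      Matrix.one_apply, h1, h2]


/-- Inserting Taylor's formula into the boundary conditions gives a linear system for `(u(0),
u_s(0))` whose matrix is `B₂`; its invertibility makes `Bc` the solution kernel. -/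
theorem IsW2.initCol_eq (hu : IsW2 L u us uss) (hL : 0 ≤ L)
    {B : Matrix (Fin 2 × Fin n) (Fin 4 × Fin n) ℝ}
    (hB : IsUnit (bcMat L B)) (hbc : B *ᵥ bdryVec L u us = 0) :
    initCol u us = MI (interval L) fun η => Bc L B η * colVec (uss η) := by
  have hZ : MLp 1 (interval L) fun η => colVec (uss η) :=
    MLp_colVec.2 (hu.memLp.mono_exponent one_le_two)
  have hc : MLp 1 (interval L) fun η => blockCol n ![0, L - η, 0, 1] * colVec (uss η) := by
    refine MLp.topMul ((compactlyCarried_interval L).MLp_top (continuous_blockCol ?_)) hZ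
    exact continuous_pi fun i => by fin_cases i <;> simp <;> fun_prop
  have h0 : B * bdryCol L u us = 0 := by
    ext i j
    exact congrFun hbc i
  rw [hu.bdryCol_eq hL, Matrix.mul_add, ← Matrix.mul_assoc, ← MI_const_mul _ hc] at h0
  have hc' : MLp 1 (interval L) fun η => B * (blockCol n ![0, L - η, 0, 1] * colVec (uss η)) :=
    MLp.topMul (.const B) hc
  have h1 : initCol u us = -((bcMat L B)⁻¹ * MI (interval L) fun η =>
      B * (blockCol n ![0, L - η, 0, 1] * colVec (uss η))) := by
    have h2 := eq_neg_of_add_eq_zero_left h0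
    rw [← Matrix.mul_neg, ← h2, ← bcMat, ← Matrix.mul_assoc,
      Matrix.nonsing_inv_mul _ ((Matrix.isUnit_iff_isUnit_det _).1 hB), Matrix.one_mul]
  rw [h1, ← MI_const_mul _ hc', ← MI_neg]
  simp only [Bc, Matrix.neg_mul, Matrix.mul_assoc]

theorem MLp_Bc (B : Matrix (Fin 2 × Fin n) (Fin 4 × Fin n) ℝ) : MLp ⊤ (interval L) (Bc L B) :=
  (compactlyCarried_interval L).MLp_top (continuous_Bc L B)

theorem IsW2.u_eq_MI (hu : IsW2 L u us uss) (hL : 0 ≤ L)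
    {B : Matrix (Fin 2 × Fin n) (Fin 4 × Fin n) ℝ}
    (hB : IsUnit (bcMat L B)) (hbc : B *ᵥ bdryVec L u us = 0) {s : ℝ} (hs : s ∈ Icc 0 L) :
    colVec (u s) = MI (interval L) fun η => G₁ L B s η * colVec (uss η) := by
  have hZ : MLp 1 (interval L) fun η => colVec (uss η) :=
    MLp_colVec.2 (hu.memLp.mono_exponent one_le_two)
  have hg : MemLp (fun η => ind (s - η) * (s - η)) ⊤ (interval L) :=
    ((compactlyCarried_interval L).memLp_top (by fun_prop)).mul' (p := ⊤) (q := ⊤)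
      (memLp_top_ind (by fun_prop))
  have h : colVec (u 0) + s • colVec (us 0) = blockRow n ![1, s] * initCol u us := by
    ext i j
    simp [blockRow, blockCol, initCol, Matrix.mul_apply, Fintype.sum_prod_type, Matrix.one_apply,
      colVec]
  rw [hu.colVec_u hs, h, hu.initCol_eq hL hB hbc, ← MI_const_mul _ ((MLp_Bc B).topMul hZ),
    ← MI_add (MLp.topMul (.const _) ((MLp_Bc B).topMul hZ)) (.smul_top hg hZ)]
  simp only [G₁, Matrix.add_mul, Matrix.smul_mul, Matrix.one_mul, Matrix.mul_assoc]

theorem IsW2.us_eq_MI (hu : IsW2 L u us uss) (hL : 0 ≤ L)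
    {B : Matrix (Fin 2 × Fin n) (Fin 4 × Fin n) ℝ}
    (hB : IsUnit (bcMat L B)) (hbc : B *ᵥ bdryVec L u us = 0) {s : ℝ} (hs : s ∈ Icc 0 L) :
    colVec (us s) = MI (interval L) fun η => G₂ L B s η * colVec (uss η) := by
  have hZ : MLp 1 (interval L) fun η => colVec (uss η) :=
    MLp_colVec.2 (hu.memLp.mono_exponent one_le_two)
  have h : colVec (us 0) = blockRow n ![0, 1] * initCol u us := by
    ext i j
    simp [blockRow, blockCol, initCol, Matrix.mul_apply, Fintype.sum_prod_type, Matrix.one_apply,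
      colVec]
  rw [hu.colVec_us hs, h, hu.initCol_eq hL hB hbc, ← MI_const_mul _ ((MLp_Bc B).topMul hZ),
    ← MI_add (MLp.topMul (.const _) ((MLp_Bc B).topMul hZ))
      (.smul_top (memLp_top_ind (by fun_prop)) hZ)]
  simp only [G₂, Matrix.add_mul, Matrix.smul_mul, Matrix.one_mul, Matrix.mul_assoc]

theorem IsW2.bdryCol_eq_MI (hu : IsW2 L u us uss) (hL : 0 ≤ L)
    {B : Matrix (Fin 2 × Fin n) (Fin 4 × Fin n) ℝ}
    (hB : IsUnit (bcMat L B)) (hbc : B *ᵥ bdryVec L u us = 0) :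
    bdryCol L u us = MI (interval L) fun η =>
      (bdryMat n L * Bc L B η + blockCol n ![0, L - η, 0, 1]) * colVec (uss η) := by
  have hZ : MLp 1 (interval L) fun η => colVec (uss η) :=
    MLp_colVec.2 (hu.memLp.mono_exponent one_le_two)
  have hc : MLp 1 (interval L) fun η => blockCol n ![0, L - η, 0, 1] * colVec (uss η) := by
    refine MLp.topMul ((compactlyCarried_interval L).MLp_top (continuous_blockCol ?_)) hZ
    exact continuous_pi fun i => by fin_cases i <;> simp <;> fun_prop
  rw [hu.bdryCol_eq hL, hu.initCol_eq hL hB hbc, ← MI_const_mul _ ((MLp_Bc B).topMul hZ),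
    ← MI_add (MLp.topMul (.const _) ((MLp_Bc B).topMul hZ)) hc]
  simp only [Matrix.add_mul, Matrix.mul_assoc]

end representation

/-! ### Composition of kernels -/

section composition

/-- For essential bounds only null sets matter. This covers the coordinate projections of a product,
which rescale the measure when the other factor is not a probability measure. -/
theorem MLp.comp_quasiMeasurePreserving {α β k l : Type*} [MeasurableSpace α] [MeasurableSpace β]
    {μ : Measure α} {ν : Measure β} {F : β → Matrix k l ℝ} (hF : MLp ⊤ ν F) {f : α → β}
    (hf : Measure.QuasiMeasurePreserving f μ ν) : MLp ⊤ μ fun a => F (f a) := fun i j => by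
  obtain ⟨C, hC⟩ := ae_norm_le_of_memLp_top (hF i j)
  exact memLp_top_of_bound ((hF i j).1.comp_quasiMeasurePreserving hf) C (hf.ae hC)

variable {L : ℝ} {k l m r : Type*} [Fintype l]

theorem MI_mul_MI_kernel [Fintype m] [Finite k] [Finite r] {κ : ℝ → Matrix k l ℝ}
    {G : ℝ → ℝ → Matrix l m ℝ} {Z : ℝ → Matrix m r ℝ}
    (hκ : MLp ⊤ (interval L) κ) (hG : BddKernel L G) (hZ : MLp 1 (interval L) Z) :
    MI (interval L) (fun ζ => κ ζ * MI (interval L) fun θ => G ζ θ * Z θ)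
      = MI (interval L) fun θ => MI (interval L) (fun ζ => κ ζ * G ζ θ) * Z θ := by
  have h : MLp 1 ((interval L).prod (interval L)) fun a : ℝ × ℝ => κ a.1 * G a.1 a.2 * Z a.2 :=
    (hκ.fst.topMul hG.prod).topMul hZ.snd
  have e₁ : ∀ ζ, (κ ζ * MI (interval L) fun θ => G ζ θ * Z θ)
      = MI (interval L) fun θ => κ ζ * G ζ θ * Z θ := fun ζ => by
    rw [← MI_const_mul _ ((hG.right ζ).topMul hZ)]
    simp only [Matrix.mul_assoc]
  have e₂ : ∀ θ, MI (interval L) (fun ζ => κ ζ * G ζ θ) * Z θ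
      = MI (interval L) fun ζ => κ ζ * G ζ θ * Z θ := fun θ => by
    rw [← MI_mul_const _ ((hκ.topMul (hG.left θ)).mono_exponent le_top)]
  simp only [e₁, e₂]
  exact MI_swap (F := fun ζ θ => κ ζ * G ζ θ * Z θ) h

/-- Each factor involves two of the three variables `(s, θ, ζ)`; both are pulled back to the triple
product before `ζ` is integrated out. -/
theorem MLp_MI_mul_kernel {K : ℝ → ℝ → Matrix k l ℝ} {G : ℝ → ℝ → Matrix l m ℝ}
    (hK : MLp ⊤ ((interval L).prod (interval L)) fun a => K a.1 a.2) (hG : BddKernel L G) :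
    MLp ⊤ ((interval L).prod (interval L)) fun a : ℝ × ℝ =>
      MI (interval L) fun ζ => K a.1 ζ * G ζ a.2 := by
  refine MLp.MI_top (F := fun (a : ℝ × ℝ) ζ => K a.1 ζ * G ζ a.2) (MLp.topMul ?_ ?_)
  · exact hK.comp_quasiMeasurePreserving
      (QuasiMeasurePreserving.prodMap Measure.quasiMeasurePreserving_fst (.id (interval L)))
  · exact hG.prod.swap.comp_quasiMeasurePreserving (f := fun a : (ℝ × ℝ) × ℝ => (a.1.2, a.2))
      (QuasiMeasurePreserving.prodMap Measure.quasiMeasurePreserving_snd (.id (interval L)))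

end composition

/-! ### The kernel of `⟨x, 𝒫 f⟩` -/

section greenKernel

variable {n : ℕ} (L : ℝ) (B : Matrix (Fin 2 × Fin n) (Fin 4 × Fin n) ℝ)
  (M : ℝ → Matrix (Fin n) (Fin n) ℝ) (N₁ N₂ : ℝ → ℝ → Matrix (Fin n) (Fin n) ℝ)

/-- The kernel `K` with `⟨x, 𝒫 f⟩ = ∫∫ x_ss(s)ᵀ K(s, ζ) f(ζ) dζ ds`. -/
def greenKernel (s ζ : ℝ) : Matrix (Fin n) (Fin n) ℝ :=
  PKt (interval L) M (piecewiseKernel N₁ N₂) (fun β => G₁ L B β s) ζ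

variable {L M N₁ N₂}

theorem greenKernel_def (s ζ : ℝ) : greenKernel L B M N₁ N₂ s ζ
    = PKt (interval L) M (piecewiseKernel N₁ N₂) (fun β => G₁ L B β s) ζ := rfl

theorem greenKernel_right (hM : MLp ⊤ (interval L) M) (h₁ : BddKernel L N₁) (h₂ : BddKernel L N₂)
    (s : ℝ) : MLp ⊤ (interval L) fun ζ => greenKernel L B M N₁ N₂ s ζ :=
  MLp.PKt hM (h₁.piecewise h₂).prod ((bddKernel_G₁ L B).left s)

theorem greenKernel_prod (hM : MLp ⊤ (interval L) M) (h₁ : BddKernel L N₁) (h₂ : BddKernel L N₂) :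
    MLp ⊤ ((interval L).prod (interval L)) fun a => greenKernel L B M N₁ N₂ a.1 a.2 :=
  ((bddKernel_G₁ L B).prod.swap.transpose.topMul hM.snd).add
    (MLp_MI_mul_kernel (K := fun s β => (G₁ L B β s)ᵀ) (bddKernel_G₁ L B).prod.swap.transpose
      (h₁.piecewise h₂))

theorem piecewiseKernel_mul (A : ℝ → Matrix (Fin n) (Fin n) ℝ) :
    piecewiseKernel (fun s θ => N₁ s θ * A θ) (fun s θ => N₂ s θ * A θ)
      = fun s θ => piecewiseKernel N₁ N₂ s θ * A θ := by
  ext1 s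
  ext1 θ
  simp only [piecewiseKernel, Matrix.add_mul, Matrix.smul_mul]

theorem greenKernel_mul (h₁ : BddKernel L N₁) (h₂ : BddKernel L N₂)
    (A : ℝ → Matrix (Fin n) (Fin n) ℝ) (s ζ : ℝ) :
    greenKernel L B (fun s => M s * A s) (fun s θ => N₁ s θ * A θ) (fun s θ => N₂ s θ * A θ) s ζ
      = greenKernel L B M N₁ N₂ s ζ * A ζ := by
  rw [greenKernel, piecewiseKernel_mul]
  exact PKt_mul_right (h₁.piecewise h₂) (((bddKernel_G₁ L B).left s).mono_exponent le_top) A ζ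

variable {A : ℝ → Matrix (Fin n) (Fin n) ℝ} (hM : MLp ⊤ (interval L) M) (h₁ : BddKernel L N₁)
  (h₂ : BddKernel L N₂) (hA : MLp ⊤ (interval L) A)
include hM h₁ h₂ hA

/-- The lower limit `max s η` in `map₂_eq_aux` equals `s` below the diagonal and `η` above it; this
is the only difference between the two components of `𝓛₂`. -/
theorem map₂_eq {s η : ℝ} (hs : s ∈ Icc 0 L) (hη : η ∈ Icc 0 L) :
    (η < s → (map₂ L B (fun s => M s * A s) (fun s θ => N₁ s θ * A θ)
        (fun s θ => N₂ s θ * A θ)).1 s η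
      = MI (interval L) fun ζ => greenKernel L B M N₁ N₂ s ζ * A ζ * G₂ L B ζ η) ∧
    (s < η → (map₂ L B (fun s => M s * A s) (fun s θ => N₁ s θ * A θ)
        (fun s θ => N₂ s θ * A θ)).2 s η
      = MI (interval L) fun ζ => greenKernel L B M N₁ N₂ s ζ * A ζ * G₂ L B ζ η) := by
  have hMA := hM.topMul hA
  have h₁A := h₁.mul_right hA
  have h₂A := h₂.mul_right hA
  have h := map₂_eq_aux B hMA h₁A h₂A hs hη
  rw [MI_PK_eq_MI_PKt hMA (h₁A.piecewise h₂A).prod ((bddKernel_G₁ L B).left s)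
    (((bddKernel_G₂ L B).left η).mono_exponent le_top)] at h
  simp only [← greenKernel_def, greenKernel_mul B h₁ h₂] at h
  rw [← h]
  refine ⟨fun h => ?_, fun h => ?_⟩
  · rw [max_eq_left h.le]
    rfl
  · rw [max_eq_right h.le]
    rfl

theorem map₃_eq {s η : ℝ} (hs : s ∈ Icc 0 L) (hη : η ∈ Icc 0 L) :
    (η < s → (map₃ L B (fun s => M s * A s) (fun s θ => N₁ s θ * A θ)
        (fun s θ => N₂ s θ * A θ)).1 s η
      = MI (interval L) fun ζ => greenKernel L B M N₁ N₂ s ζ * A ζ * G₁ L B ζ η) ∧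
    (s < η → (map₃ L B (fun s => M s * A s) (fun s θ => N₁ s θ * A θ)
        (fun s θ => N₂ s θ * A θ)).2 s η
      = MI (interval L) fun ζ => greenKernel L B M N₁ N₂ s ζ * A ζ * G₁ L B ζ η) := by
  have hMA := hM.topMul hA
  have h₁A := h₁.mul_right hA
  have h₂A := h₂.mul_right hA
  have h := map₃_eq_aux B hMA h₁A h₂A hs hη
  rw [MI_PK_eq_MI_PKt hMA (h₁A.piecewise h₂A).prod ((bddKernel_G₁ L B).left s)
    (((bddKernel_G₁ L B).left η).mono_exponent le_top)] at h
  simp only [← greenKernel_def, greenKernel_mul B h₁ h₂] at h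
  rw [← h]
  refine ⟨fun h => ?_, fun h => ?_⟩
  · rw [max_eq_left h.le]
    rfl
  · rw [max_eq_right h.le]
    rfl

omit hM in
theorem map₁_eq {s θ : ℝ} (hs : s ∈ Icc 0 L) (hθ : θ ∈ Icc 0 L) :
    (θ < s → (map₁ L B (fun s => M s * A s) (fun s θ => N₁ s θ * A θ)
        (fun s θ => N₂ s θ * A θ)).1 s θ = greenKernel L B M N₁ N₂ s θ * A θ) ∧
    (s < θ → (map₁ L B (fun s => M s * A s) (fun s θ => N₁ s θ * A θ)
        (fun s θ => N₂ s θ * A θ)).2 s θ = greenKernel L B M N₁ N₂ s θ * A θ) := by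
  simp only [← greenKernel_mul B h₁ h₂]
  exact ⟨map₁_fst B (h₁.mul_right hA) (h₂.mul_right hA) hs hθ,
    map₁_snd B (h₁.mul_right hA) (h₂.mul_right hA) hs hθ⟩

end greenKernel

/-! ### The state kernel and the kernels of the passivity test. -/

section system

variable {n q : ℕ} (S : PDESystem n q q)
  (M : ℝ → Matrix (Fin n) (Fin n) ℝ) (N₁ N₂ : ℝ → ℝ → Matrix (Fin n) (Fin n) ℝ)

/-- The kernel `H` with `⟨x, 𝒫 (A₀ x + A₁ x_s + A₂ x_ss)⟩ = ∫∫ x_ss(s)ᵀ H(s, θ) x_ss(θ) dθ ds`. -/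
def stateKernel (s θ : ℝ) : Matrix (Fin n) (Fin n) ℝ :=
  MI (interval S.L) (fun ζ => greenKernel S.L S.B M N₁ N₂ s ζ * S.A₀ ζ * G₁ S.L S.B ζ θ)
    + MI (interval S.L) (fun ζ => greenKernel S.L S.B M N₁ N₂ s ζ * S.A₁ ζ * G₂ S.L S.B ζ θ)
    + greenKernel S.L S.B M N₁ N₂ s θ * S.A₂ θ

variable {S M N₁ N₂} (hM : MLp ⊤ (interval S.L) M) (h₁ : BddKernel S.L N₁)
  (h₂ : BddKernel S.L N₂) (hA₀ : EssBounded S.L S.A₀) (hA₁ : EssBounded S.L S.A₁)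
  (hA₂ : EssBounded S.L S.A₂)
include hM h₁ h₂ hA₀ hA₁ hA₂

theorem passH_fst {s θ : ℝ} (hs : s ∈ Icc 0 S.L) (hθ : θ ∈ Icc 0 S.L) (h : θ < s) :
    (passH S M N₁ N₂).1 s θ = stateKernel S M N₁ N₂ s θ := by
  rw [stateKernel, ← (map₃_eq S.B hM h₁ h₂ hA₀ hs hθ).1 h, ← (map₂_eq S.B hM h₁ h₂ hA₁ hs hθ).1 h,
    ← (map₁_eq S.B h₁ h₂ hA₂ hs hθ).1 h]
  rfl

theorem passH_snd {s θ : ℝ} (hs : s ∈ Icc 0 S.L) (hθ : θ ∈ Icc 0 S.L) (h : s < θ) :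
    (passH S M N₁ N₂).2 s θ = stateKernel S M N₁ N₂ s θ := by
  rw [stateKernel, ← (map₃_eq S.B hM h₁ h₂ hA₀ hs hθ).2 h, ← (map₂_eq S.B hM h₁ h₂ hA₁ hs hθ).2 h,
    ← (map₁_eq S.B h₁ h₂ hA₂ hs hθ).2 h]
  rfl

theorem stateKernel_prod : MLp ⊤ ((interval S.L).prod (interval S.L)) fun a =>
    stateKernel S M N₁ N₂ a.1 a.2 := by
  have hK := greenKernel_prod S.B hM h₁ h₂
  refine .add (.add (MLp_MI_mul_kernel (K := fun s ζ => greenKernel S.L S.B M N₁ N₂ s ζ * S.A₀ ζ)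
    (hK.topMul (MLp.snd hA₀)) (bddKernel_G₁ _ _)) (MLp_MI_mul_kernel
    (K := fun s ζ => greenKernel S.L S.B M N₁ N₂ s ζ * S.A₁ ζ)
    (hK.topMul (MLp.snd hA₁)) (bddKernel_G₂ _ _))) (hK.topMul (MLp.snd hA₂))

/-- For `θ < s` the term `H₁(s, θ)` is evaluated below the diagonal and `H₂(θ, s)` above it, where
both agree with the single kernel `H`; so the test kernels are the two halves of the symmetrisation
`H(s, θ) + H(θ, s)ᵀ`. -/
theorem passR_eq {s θ : ℝ} (hs : s ∈ Icc 0 S.L) (hθ : θ ∈ Icc 0 S.L) :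
    (θ < s → passR₁ S M N₁ N₂ s θ
      = stateKernel S M N₁ N₂ s θ + (stateKernel S M N₁ N₂ θ s)ᵀ) ∧
    (s < θ → passR₂ S M N₁ N₂ s θ
      = stateKernel S M N₁ N₂ s θ + (stateKernel S M N₁ N₂ θ s)ᵀ) := by
  refine ⟨fun h => ?_, fun h => ?_⟩
  · rw [passR₁, passH_fst hM h₁ h₂ hA₀ hA₁ hA₂ hs hθ h, passH_snd hM h₁ h₂ hA₀ hA₁ hA₂ hθ hs h]
  · rw [passR₂, passR₁, passH_fst hM h₁ h₂ hA₀ hA₁ hA₂ hθ hs h,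
      passH_snd hM h₁ h₂ hA₀ hA₁ hA₂ hs hθ h, Matrix.transpose_add, Matrix.transpose_transpose,
      add_comm]

/-- The kernel form of `⟨x, 𝒫 f⟩` applied to the right-hand side of the state equation. -/
theorem MI_greenKernel_rhs (hB₁ : EssBounded S.L S.B₁) {Z : ℝ → Matrix (Fin n) (Fin 1) ℝ}
    (hZ : MLp 1 (interval S.L) Z) (W : Matrix (Fin q) (Fin 1) ℝ) (s : ℝ) :
    MI (interval S.L) (fun ζ => greenKernel S.L S.B M N₁ N₂ s ζ *
        (S.A₀ ζ * MI (interval S.L) (fun θ => G₁ S.L S.B ζ θ * Z θ)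
          + S.A₁ ζ * MI (interval S.L) (fun θ => G₂ S.L S.B ζ θ * Z θ) + S.A₂ ζ * Z ζ
          + S.B₁ ζ * W))
      = MI (interval S.L) (fun θ => stateKernel S M N₁ N₂ s θ * Z θ)
        + MI (interval S.L) (fun ζ => greenKernel S.L S.B M N₁ N₂ s ζ * S.B₁ ζ) * W := by
  have hK := greenKernel_right S.B hM h₁ h₂ s
  have hG₁ := bddKernel_G₁ S.L S.B
  have hG₂ := bddKernel_G₂ S.L S.B
  have k₀ := hK.topMul hA₀
  have k₁ := hK.topMul hA₁
  have k₂ := hK.topMul hA₂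
  have k₃ := hK.topMul hB₁
  have x₁ := (hG₁.prod.kernel_mul (N := G₁ S.L S.B) hZ).mono_exponent (p := 1) le_top
  have x₂ := (hG₂.prod.kernel_mul (N := G₂ S.L S.B) hZ).mono_exponent (p := 1) le_top
  have w₁ : MLp 1 (interval S.L) fun _ => W := .mono_exponent (.const W) le_top
  simp only [Matrix.mul_add, ← Matrix.mul_assoc]
  rw [MI_add (((k₀.topMul x₁).add (k₁.topMul x₂)).add (k₂.topMul hZ)) (k₃.topMul w₁),
    MI_add ((k₀.topMul x₁).add (k₁.topMul x₂)) (k₂.topMul hZ),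
    MI_add (k₀.topMul x₁) (k₁.topMul x₂), MI_mul_const _ (k₃.mono_exponent le_top),
    MI_mul_MI_kernel k₀ hG₁ hZ, MI_mul_MI_kernel k₁ hG₂ hZ]
  have j₀ : MLp ⊤ (interval S.L) fun θ => MI (interval S.L) fun ζ =>
      greenKernel S.L S.B M N₁ N₂ s ζ * S.A₀ ζ * G₁ S.L S.B ζ θ :=
    MLp.MI_top (F := fun θ ζ => greenKernel S.L S.B M N₁ N₂ s ζ * S.A₀ ζ * G₁ S.L S.B ζ θ)
      (k₀.snd.topMul hG₁.prod.swap)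
  have j₁ : MLp ⊤ (interval S.L) fun θ => MI (interval S.L) fun ζ =>
      greenKernel S.L S.B M N₁ N₂ s ζ * S.A₁ ζ * G₂ S.L S.B ζ θ :=
    MLp.MI_top (F := fun θ ζ => greenKernel S.L S.B M N₁ N₂ s ζ * S.A₁ ζ * G₂ S.L S.B ζ θ)
      (k₁.snd.topMul hG₂.prod.swap)
  rw [← MI_add (j₀.topMul hZ) (j₁.topMul hZ),
    ← MI_add ((j₀.topMul hZ).add (j₁.topMul hZ)) (k₂.topMul hZ)]
  simp only [stateKernel, Matrix.add_mul]

end system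

/-! ### The dissipation inequality at a fixed time -/

section dissipation

variable {L : ℝ} {k l r : Type*} [Fintype k] [Fintype l]

/-- The outer factors depend on different variables, so their product is integrable on the product
space with each of them merely in `L¹`. -/
theorem MLp.mul_kernel_mul {α β m r : Type*} [MeasurableSpace α] [MeasurableSpace β]
    {μ : Measure α} {ν : Measure β} [SFinite μ] [SFinite ν] {X : α → Matrix m k ℝ}
    {N : α → β → Matrix k l ℝ} {Y : β → Matrix l r ℝ} (hX : MLp 1 μ X)
    (hN : MLp ⊤ (μ.prod ν) fun a => N a.1 a.2) (hY : MLp 1 ν Y) :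
    MLp 1 (μ.prod ν) fun a => X a.1 * (N a.1 a.2 * Y a.2) := by
  intro i j
  simp only [Matrix.mul_apply, Finset.mul_sum]
  refine memLp_finsetSum _ fun x _ => memLp_finsetSum _ fun y _ => ?_
  have h : MemLp (fun a : α × β => N a.1 a.2 x y * (X a.1 i x * Y a.2 y j)) 1 (μ.prod ν) :=
    (memLp_one_iff_integrable.2 ((hX.integrable i x).mul_prod (hY.integrable y j))).mul'
      (p := ⊤) (q := 1) (hN x y)
  refine h.ae_eq (Filter.Eventually.of_forall fun a => ?_)
  dsimp only
  ring

/-- The transposed kernel gives the same quadratic form up to transposition, so the symmetrised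
kernel contributes twice the scalar form of `H`. -/
theorem MI_transpose_mul_MI_transpose [Finite r] {H : ℝ → ℝ → Matrix k k ℝ} {Z : ℝ → Matrix k r ℝ}
    (hH : MLp ⊤ ((interval L).prod (interval L)) fun a => H a.1 a.2)
    (hZ : MLp 1 (interval L) Z) :
    MI (interval L) (fun s => (Z s)ᵀ * MI (interval L) fun θ => (H θ s)ᵀ * Z θ)
      = (MI (interval L) fun s => (Z s)ᵀ * MI (interval L) fun θ => H s θ * Z θ)ᵀ := by
  have hHZ : MLp 1 ((interval L).prod (interval L)) fun a : ℝ × ℝ => H a.1 a.2 * Z a.2 :=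
    hH.topMul hZ.snd
  have hHZ' : MLp 1 ((interval L).prod (interval L)) fun a : ℝ × ℝ => (H a.2 a.1)ᵀ * Z a.2 :=
    hH.swap.transpose.topMul hZ.snd
  have hZHZ : MLp 1 ((interval L).prod (interval L)) fun a : ℝ × ℝ =>
      (Z a.1)ᵀ * ((H a.2 a.1)ᵀ * Z a.2) :=
    MLp.mul_kernel_mul hZ.transpose (N := fun s θ => (H θ s)ᵀ) hH.swap.transpose hZ
  have e₁ : MI (interval L) (fun s => (Z s)ᵀ * MI (interval L) fun θ => (H θ s)ᵀ * Z θ)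
      = MI (interval L) fun s => MI (interval L) fun θ => (Z s)ᵀ * ((H θ s)ᵀ * Z θ) := by
    refine MI_congr ?_
    filter_upwards [MLp.ae_right (F := fun s θ => (H θ s)ᵀ * Z θ) hHZ'] with s hs
    rw [MI_const_mul _ hs]
  have e₂ : MI (interval L) (fun s => (Z s)ᵀ * MI (interval L) fun θ => H s θ * Z θ)
      = MI (interval L) fun s => MI (interval L) fun θ => (Z s)ᵀ * (H s θ * Z θ) := by
    refine MI_congr ?_
    filter_upwards [MLp.ae_right (F := fun s θ => H s θ * Z θ) hHZ] with s hs
    rw [MI_const_mul _ hs]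
  rw [e₁, e₂, MI_swap (F := fun s θ => (Z s)ᵀ * ((H θ s)ᵀ * Z θ)) hZHZ]
  simp only [MI_transpose, Matrix.transpose_mul, Matrix.transpose_transpose, Matrix.mul_assoc]

variable {n q : ℕ}

/-- `⟨x, 𝒫 f⟩` through `x_ss`, for `x = ∫ G₁(·, η) x_ss(η) dη`. -/
theorem MI_PK_eq_greenKernel (B : Matrix (Fin 2 × Fin n) (Fin 4 × Fin n) ℝ)
    {M : ℝ → Matrix (Fin n) (Fin n) ℝ} {N₁ N₂ : ℝ → ℝ → Matrix (Fin n) (Fin n) ℝ}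
    (hM : MLp ⊤ (interval L) M) (h₁ : BddKernel L N₁) (h₂ : BddKernel L N₂)
    {Z F : ℝ → Matrix (Fin n) (Fin 1) ℝ} (hZ : MLp 1 (interval L) Z)
    (hF : MLp 1 (interval L) F) :
    MI (interval L) (fun β => (MI (interval L) fun s => G₁ L B β s * Z s)ᵀ
        * PK (interval L) M (piecewiseKernel N₁ N₂) F β)
      = MI (interval L) fun s => (Z s)ᵀ * MI (interval L) fun ζ =>
          greenKernel L B M N₁ N₂ s ζ * F ζ := by
  have hG := bddKernel_G₁ L B
  have hN := (h₁.piecewise h₂).prod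
  have hP := MLp.PK le_rfl hM hN hF
  have e₁ : ∀ β, (MI (interval L) fun s => G₁ L B β s * Z s)ᵀ
        * PK (interval L) M (piecewiseKernel N₁ N₂) F β
      = MI (interval L) fun s => (Z s)ᵀ * ((G₁ L B β s)ᵀ
        * PK (interval L) M (piecewiseKernel N₁ N₂) F β) := fun β => by
    rw [MI_transpose, ← MI_mul_const _ ((((hG.right β).topMul hZ).transpose))]
    simp only [Matrix.transpose_mul, Matrix.mul_assoc]
  have h := MLp.mul_kernel_mul hZ.transpose (N := fun s β => (G₁ L B β s)ᵀ)
    hG.prod.swap.transpose hP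
  simp only [e₁]
  rw [MI_swap (F := fun β s => (Z s)ᵀ * ((G₁ L B β s)ᵀ
        * PK (interval L) M (piecewiseKernel N₁ N₂) F β)) h.swap]
  refine congrArg _ (funext fun s => ?_)
  rw [MI_const_mul _ ((hG.left s).transpose.topMul hP), MI_PK_eq_MI_PKt hM hN (hG.left s) hF]
  rfl

theorem colVec_opPQRSfst {P : Matrix (Fin q) (Fin q) ℝ} {Q : ℝ → Matrix (Fin q) (Fin n) ℝ}
    (hL : 0 ≤ L) (hQ : MLp ⊤ (interval L) Q) {z : ℝ → Vec n} (hz : MemLp z 1 (interval L))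
    (w : Vec q) :
    colVec (opPQRSfst L P Q w z) = P * colVec w
      + (1 / L) • MI (interval L) fun s => Q s * colVec (z s) := by
  rw [opPQRSfst, colVec_add, colVec_smul, colVec_mv, colVec_intervalIntegral le_rfl hL le_rfl,
    matInt_full hL]
  · simp only [colVec_mv]
  · exact MLp_colVec_mv_iff.2 (hQ.topMul (MLp_colVec.2 hz))

/-- `R₁` and `R₂` need to agree with one kernel `R` only strictly off the diagonal, because for
fixed `s` the point `θ = s` is null. -/
theorem colVec_opPQRSsnd {Q : ℝ → Matrix (Fin q) (Fin n) ℝ}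
    {R R₁ R₂ : ℝ → ℝ → Matrix (Fin n) (Fin n) ℝ} {z : ℝ → Vec n} {s : ℝ} (hs : s ∈ Icc 0 L)
    (h₁ : ∀ θ ∈ Icc 0 L, θ < s → R₁ s θ = R s θ) (h₂ : ∀ θ ∈ Icc 0 L, s < θ → R₂ s θ = R s θ)
    (hR : MLp 1 (interval L) fun θ => R s θ * colVec (z θ)) (w : Vec q) :
    colVec (opPQRSsnd L Q R₁ R₂ w z s) = (Q s)ᵀ * colVec w
      + MI (interval L) fun θ => R s θ * colVec (z θ) := by
  have hR' : MemLp (fun θ => mv (R s θ) (z θ)) 1 (interval L) := MLp_colVec_mv_iff.2 hR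
  have e₁ : ∫ θ in (0 : ℝ)..s, mv (R₁ s θ) (z θ) = ∫ θ in (0 : ℝ)..s, mv (R s θ) (z θ) := by
    refine intervalIntegral.integral_congr_ae ((Measure.ae_ne volume s).mono fun θ hθ hm => ?_)
    rw [uIoc_of_le hs.1] at hm
    rw [h₁ θ ⟨hm.1.le, hm.2.trans hs.2⟩ (lt_of_le_of_ne hm.2 hθ)]
  have e₂ : ∫ θ in s..L, mv (R₂ s θ) (z θ) = ∫ θ in s..L, mv (R s θ) (z θ) := by
    refine intervalIntegral.integral_congr_ae (Filter.Eventually.of_forall fun θ hm => ?_)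
    rw [uIoc_of_le hs.2] at hm
    rw [h₂ θ ⟨hs.1.trans hm.1.le, hm.2⟩ hm.1]
  rw [opPQRSsnd, e₁, e₂, colVec_add, colVec_add, colVec_mv,
    colVec_intervalIntegral le_rfl hs.1 hs.2 hR', colVec_intervalIntegral hs.1 hs.2 le_rfl hR',
    matInt_left hs, matInt_right hs, add_assoc, ← MI_add]
  · refine congrArg _ (MI_congr ?_)
    filter_upwards [ae_ne_interval L s] with θ hθ
    rw [colVec_mv]
    rcases lt_or_gt_of_ne hθ with h | h
    · rw [ind_of_nonneg (by linarith), ind_of_neg (by linarith), one_smul, zero_smul, add_zero]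
    · rw [ind_of_neg (by linarith), ind_of_nonneg (by linarith), one_smul, zero_smul, zero_add]
  · simp only [colVec_mv]
    exact .smul_top (memLp_top_ind (by fun_prop)) hR
  · simp only [colVec_mv]
    exact .smul_top (memLp_top_ind (by fun_prop)) hR

/-- The output through `u_ss`. -/
theorem colVec_output {S : PDESystem n q q} (hL : 0 ≤ S.L) (hCa : EssBounded S.L S.Ca)
    (hCb : EssBounded S.L S.Cb) (hB : IsUnit (bcMat S.L S.B)) {u us uss : ℝ → Vec n}
    (hu : IsW2 S.L u us uss) (hbc : S.B *ᵥ bdryVec S.L u us = 0) (w : Vec q) :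
    colVec (WithLp.toLp 2 (S.C₁ *ᵥ bdryVec S.L u us)
        + (∫ s in (0 : ℝ)..S.L, (mv (S.Ca s) (u s) + mv (S.Cb s) (us s))) + mv S.D₁ w)
      = MI (interval S.L) (fun θ => C₃ S θ * colVec (uss θ)) + S.D₁ * colVec w := by
  have hZ : MLp 1 (interval S.L) fun η => colVec (uss η) :=
    MLp_colVec.2 (hu.memLp.mono_exponent one_le_two)
  have hG₁ := bddKernel_G₁ S.L S.B
  have hG₂ := bddKernel_G₂ S.L S.B
  have x₁ := (hG₁.prod.kernel_mul (N := G₁ S.L S.B) hZ).mono_exponent (p := 1) le_top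
  have x₂ := (hG₂.prod.kernel_mul (N := G₂ S.L S.B) hZ).mono_exponent (p := 1) le_top
  have y₁ := MLp.topMul hCa x₁
  have y₂ := MLp.topMul hCb x₂
  have hc : MLp ⊤ (interval S.L) fun η =>
      bdryMat n S.L * Bc S.L S.B η + blockCol n ![0, S.L - η, 0, 1] := by
    refine MLp.add (.topMul (.const _) (MLp_Bc S.B))
      ((compactlyCarried_interval S.L).MLp_top (continuous_blockCol ?_))
    exact continuous_pi fun i => by fin_cases i <;> simp <;> fun_prop
  have hm : ∀ᵐ s ∂interval S.L, colVec (mv (S.Ca s) (u s) + mv (S.Cb s) (us s))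
      = S.Ca s * MI (interval S.L) (fun θ => G₁ S.L S.B s θ * colVec (uss θ))
        + S.Cb s * MI (interval S.L) fun θ => G₂ S.L S.B s θ * colVec (uss θ) := by
    filter_upwards [ae_mem_interval S.L] with s hs
    rw [colVec_add, colVec_mv, colVec_mv, hu.u_eq_MI hL hB hbc hs, hu.us_eq_MI hL hB hbc hs]
  have hi : MemLp (fun s => mv (S.Ca s) (u s) + mv (S.Cb s) (us s)) 1 (interval S.L) :=
    MLp_colVec.1 ((y₁.add y₂).congr (hm.mono fun s hs => hs.symm))
  have hb : colVec (WithLp.toLp 2 (S.C₁ *ᵥ bdryVec S.L u us)) = S.C₁ * bdryCol S.L u us := by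
    ext i j
    simp [colVec, bdryCol, Matrix.mul_apply, Matrix.mulVec, dotProduct]
  have j₁ : MLp ⊤ (interval S.L) fun θ => MI (interval S.L) fun s => S.Ca s * G₁ S.L S.B s θ :=
    MLp.MI_top (F := fun θ s => S.Ca s * G₁ S.L S.B s θ) ((MLp.snd hCa).topMul hG₁.prod.swap)
  have j₂ : MLp ⊤ (interval S.L) fun θ => MI (interval S.L) fun s => S.Cb s * G₂ S.L S.B s θ :=
    MLp.MI_top (F := fun θ s => S.Cb s * G₂ S.L S.B s θ) ((MLp.snd hCb).topMul hG₂.prod.swap)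
  have hC : MLp 1 (interval S.L) fun θ => S.C₁ *
      ((bdryMat n S.L * Bc S.L S.B θ + blockCol n ![0, S.L - θ, 0, 1]) * colVec (uss θ)) :=
    MLp.topMul (.const _) (hc.topMul hZ)
  rw [colVec_add, colVec_add, hb, colVec_mv, hu.bdryCol_eq_MI hL hB hbc,
    colVec_intervalIntegral le_rfl hL le_rfl hi, matInt_full hL, MI_congr hm, MI_add y₁ y₂,
    MI_mul_MI_kernel hCa hG₁ hZ, MI_mul_MI_kernel hCb hG₂ hZ,
    ← MI_add (j₁.topMul hZ) (j₂.topMul hZ), ← MI_const_mul _ (hc.topMul hZ), ← MI_add hC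
    ((j₁.topMul hZ).add (j₂.topMul hZ))]
  refine congrArg (· + _) (congrArg _ (funext fun θ => ?_))
  rw [C₃, matInt_full hL, MI_add ((MLp.topMul hCa (hG₁.left θ)).mono_exponent le_top)
    ((MLp.topMul hCb (hG₂.left θ)).mono_exponent le_top)]
  simp only [Matrix.add_mul, Matrix.mul_add, Matrix.mul_assoc]

end dissipation

section dissipationInequality

variable {n q : ℕ} {S : PDESystem n q q}
  {M : ℝ → Matrix (Fin n) (Fin n) ℝ} {N₁ N₂ : ℝ → ℝ → Matrix (Fin n) (Fin n) ℝ}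

theorem MLp_C₃ (hL : 0 ≤ S.L) (hCa : EssBounded S.L S.Ca) (hCb : EssBounded S.L S.Cb) :
    MLp ⊤ (interval S.L) (C₃ S) := by
  have hG₁ := bddKernel_G₁ S.L S.B
  have hG₂ := bddKernel_G₂ S.L S.B
  have hc : MLp ⊤ (interval S.L) fun η =>
      bdryMat n S.L * Bc S.L S.B η + blockCol n ![0, S.L - η, 0, 1] := by
    refine MLp.add (.topMul (.const _) (MLp_Bc S.B))
      ((compactlyCarried_interval S.L).MLp_top (continuous_blockCol ?_))
    exact continuous_pi fun i => by fin_cases i <;> simp <;> fun_prop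
  have h : MLp ⊤ (interval S.L) fun θ => MI (interval S.L) fun s =>
      S.Ca s * G₁ S.L S.B s θ + S.Cb s * G₂ S.L S.B s θ :=
    MLp.MI_top (F := fun θ s => S.Ca s * G₁ S.L S.B s θ + S.Cb s * G₂ S.L S.B s θ)
      (((MLp.snd hCa).topMul hG₁.prod.swap).add ((MLp.snd hCb).topMul hG₂.prod.swap))
  simp only [← matInt_full hL] at h
  exact (MLp.topMul (.const S.C₁) hc).add h

theorem passQ_eq (hL : 0 ≤ S.L) (h₁ : BddKernel S.L N₁) (h₂ : BddKernel S.L N₂) (s : ℝ) :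
    passQ S M N₁ N₂ s
      = -C₃ S s + (MI (interval S.L) fun θ => greenKernel S.L S.B M N₁ N₂ s θ * S.B₁ θ)ᵀ := by
  rw [passQ, matInt_full hL, MI_transpose]
  refine congrArg _ (MI_congr ?_)
  filter_upwards [ae_mem_interval S.L] with θ hθ
  rw [kerV, PKt_piecewise h₁ h₂ ((bddKernel_G₁ S.L S.B).left s) hθ]
  rfl

/-- The right-hand side of the state equation. -/
def stateRhs (S : PDESystem n q q) (u us uss : ℝ → Vec n) (w : Vec q) (s : ℝ) : Vec n :=
  mv (S.A₀ s) (u s) + mv (S.A₁ s) (us s) + mv (S.A₂ s) (uss s) + mv (S.B₁ s) w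

/-- The test is applied to the pair `(w, uss)`. Its value is twice the left-hand side minus twice
the right-hand side, so its sign is the claim. No equation in time enters: `w` is an arbitrary
vector. -/
theorem ip_opP_stateRhs_le (hL : 0 < S.L)
    (hA₀ : EssBounded S.L S.A₀) (hA₁ : EssBounded S.L S.A₁)
    (hA₂ : EssBounded S.L S.A₂) (hB₁ : EssBounded S.L S.B₁)
    (hCa : EssBounded S.L S.Ca) (hCb : EssBounded S.L S.Cb)
    (hB : IsUnit (bcMat S.L S.B))
    (hM : MLp ⊤ (interval S.L) M) (h₁ : BddKernel S.L N₁) (h₂ : BddKernel S.L N₂)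
    (hneg : PQRSNonpos S.L (passP S) (passQ S M N₁ N₂) (passR₁ S M N₁ N₂) (passR₂ S M N₁ N₂))
    {u us uss : ℝ → Vec n} (hu : IsW2 S.L u us uss) (hbc : S.B *ᵥ bdryVec S.L u us = 0)
    (w : Vec q) :
    ip S.L u (opP S.L M N₁ N₂ (stateRhs S u us uss w))
      ≤ inner ℝ w (WithLp.toLp 2 (S.C₁ *ᵥ bdryVec S.L u us)
        + (∫ s in (0 : ℝ)..S.L, (mv (S.Ca s) (u s) + mv (S.Cb s) (us s))) + mv S.D₁ w) := by
  set Z : ℝ → Matrix (Fin n) (Fin 1) ℝ := fun s => colVec (uss s) with hZdef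
  set W := colVec w with hW
  have hZ : MLp 1 (interval S.L) Z := MLp_colVec.2 (hu.memLp.mono_exponent one_le_two)
  have hG₁ := bddKernel_G₁ S.L S.B
  have hG₂ := bddKernel_G₂ S.L S.B
  have x₁ := (hG₁.prod.kernel_mul (N := G₁ S.L S.B) hZ).mono_exponent (p := 1) le_top
  have x₂ := (hG₂.prod.kernel_mul (N := G₂ S.L S.B) hZ).mono_exponent (p := 1) le_top
  set F : ℝ → Matrix (Fin n) (Fin 1) ℝ := fun ζ =>
    S.A₀ ζ * MI (interval S.L) (fun θ => G₁ S.L S.B ζ θ * Z θ)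
      + S.A₁ ζ * MI (interval S.L) (fun θ => G₂ S.L S.B ζ θ * Z θ) + S.A₂ ζ * Z ζ
      + S.B₁ ζ * W with hFdef
  have hF : MLp 1 (interval S.L) F :=
    (((MLp.topMul hA₀ x₁).add (MLp.topMul hA₁ x₂)).add (MLp.topMul hA₂ hZ)).add
      (MLp.topMul hB₁ (.mono_exponent (.const W) le_top))
  have hfF : ∀ᵐ s ∂interval S.L, F s = colVec (stateRhs S u us uss w s) := by
    filter_upwards [ae_mem_interval S.L] with s hs
    rw [stateRhs, colVec_add, colVec_add, colVec_add, colVec_mv, colVec_mv, colVec_mv, colVec_mv,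
      hu.u_eq_MI hL.le hB hbc hs, hu.us_eq_MI hL.le hB hbc hs]
  have hf : MemLp (stateRhs S u us uss w) 1 (interval S.L) := MLp_colVec.1 (hF.congr hfF)
  have hH := stateKernel_prod hM h₁ h₂ hA₀ hA₁ hA₂
  have hHZ : MLp 1 ((interval S.L).prod (interval S.L)) fun a : ℝ × ℝ =>
      stateKernel S M N₁ N₂ a.1 a.2 * Z a.2 := hH.topMul hZ.snd
  have hHZ' : MLp 1 ((interval S.L).prod (interval S.L)) fun a : ℝ × ℝ =>
      (stateKernel S M N₁ N₂ a.2 a.1)ᵀ * Z a.2 := hH.swap.transpose.topMul hZ.snd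
  have hKB : MLp ⊤ (interval S.L) fun s =>
      MI (interval S.L) fun ζ => greenKernel S.L S.B M N₁ N₂ s ζ * S.B₁ ζ :=
    MLp.MI_top (F := fun s ζ => greenKernel S.L S.B M N₁ N₂ s ζ * S.B₁ ζ)
      ((greenKernel_prod S.B hM h₁ h₂).topMul (MLp.snd hB₁))
  have hC := MLp_C₃ hL.le hCa hCb
  have hQ : MLp ⊤ (interval S.L) (passQ S M N₁ N₂) :=
    (hC.neg.add hKB.transpose).congr
      (Filter.Eventually.of_forall fun s => (passQ_eq hL.le h₁ h₂ s).symm)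
  -- The building blocks: `a` is the quadratic form of `H` in `uss`, `b` the cross term from `B₁ w`,
  -- and `c` the part of the output coming from the state.
  set a : Matrix (Fin 1) (Fin 1) ℝ := MI (interval S.L) fun s =>
    (Z s)ᵀ * MI (interval S.L) fun θ => stateKernel S M N₁ N₂ s θ * Z θ with ha
  set b : Matrix (Fin 1) (Fin 1) ℝ := MI (interval S.L) fun s =>
    (Z s)ᵀ * ((MI (interval S.L) fun ζ => greenKernel S.L S.B M N₁ N₂ s ζ * S.B₁ ζ) * W) with hb
  set c : Matrix (Fin q) (Fin 1) ℝ := MI (interval S.L) fun s => C₃ S s * Z s with hc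
  have za : MLp 1 (interval S.L) fun s =>
      (Z s)ᵀ * MI (interval S.L) fun θ => stateKernel S M N₁ N₂ s θ * Z θ :=
    hZ.transpose.mulTop (hH.kernel_mul (N := stateKernel S M N₁ N₂) hZ)
  have za' : MLp 1 (interval S.L) fun s =>
      (Z s)ᵀ * MI (interval S.L) fun θ => (stateKernel S M N₁ N₂ θ s)ᵀ * Z θ :=
    hZ.transpose.mulTop
      (MLp.kernel_mul (N := fun s θ => (stateKernel S M N₁ N₂ θ s)ᵀ) hH.swap.transpose hZ)
  have zb : MLp 1 (interval S.L) fun s =>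
      (Z s)ᵀ * ((MI (interval S.L) fun ζ => greenKernel S.L S.B M N₁ N₂ s ζ * S.B₁ ζ) * W) :=
    hZ.transpose.mulTop (hKB.mulTop (.const W))
  have zc : MLp 1 (interval S.L) fun s => C₃ S s * Z s := hC.topMul hZ
  -- the left-hand side
  have hip : ip S.L u (opP S.L M N₁ N₂ (stateRhs S u us uss w)) = a 0 0 + b 0 0 := by
    have e : MI (interval S.L) (fun s => (colVec (u s))ᵀ
          * colVec (opP S.L M N₁ N₂ (stateRhs S u us uss w) s))
        = MI (interval S.L) fun s => (MI (interval S.L) fun η => G₁ S.L S.B s η * Z η)ᵀ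
          * PK (interval S.L) M (piecewiseKernel N₁ N₂) F s := by
      have hPK : ∀ s, PK (interval S.L) M (piecewiseKernel N₁ N₂)
          (fun θ => colVec (stateRhs S u us uss w θ)) s
          = M s * colVec (stateRhs S u us uss w s)
            + MI (interval S.L) fun θ => piecewiseKernel N₁ N₂ s θ * F θ := fun s =>
        congrArg _ (MI_congr (hfF.mono fun θ hθ => by rw [hθ]))
      refine MI_congr ?_
      filter_upwards [ae_mem_interval S.L, hfF] with s hs hs'
      rw [colVec_opP h₁ h₂ hf hs, hu.u_eq_MI hL.le hB hbc hs, hPK, ← hs']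
      rfl
    rw [ip_eq_MI hL.le, e, MI_PK_eq_greenKernel S.B hM h₁ h₂ hZ hF]
    simp only [hFdef, MI_greenKernel_rhs hM h₁ h₂ hA₀ hA₁ hA₂ hB₁ hZ W]
    simp only [Matrix.mul_add]
    rw [MI_add za zb]
    rfl
  -- the supply rate
  have hsup : inner ℝ w (WithLp.toLp 2 (S.C₁ *ᵥ bdryVec S.L u us)
        + (∫ s in (0 : ℝ)..S.L, (mv (S.Ca s) (u s) + mv (S.Cb s) (us s))) + mv S.D₁ w)
      = (Wᵀ * c) 0 0 + (Wᵀ * (S.D₁ * W)) 0 0 := by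
    rw [inner_eq_colVec, colVec_output hL.le hCa hCb hB hu hbc, Matrix.mul_add]
    rfl
  -- the test inequality
  have hfst : ip S.L (fun _ => w) (fun _ => opPQRSfst S.L (passP S) (passQ S M N₁ N₂) w uss)
      = -(2 * (Wᵀ * (S.D₁ * W)) 0 0) + (-(Wᵀ * c) 0 0 + b 0 0) := by
    have hQZ : MI (interval S.L) (fun s => passQ S M N₁ N₂ s * Z s)
        = -c + MI (interval S.L) fun s =>
          (MI (interval S.L) fun ζ => greenKernel S.L S.B M N₁ N₂ s ζ * S.B₁ ζ)ᵀ * Z s := by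
      rw [hc, ← MI_neg, ← MI_add zc.neg (hKB.transpose.topMul hZ)]
      simp only [passQ_eq hL.le h₁ h₂, Matrix.add_mul, Matrix.neg_mul]
    have hWb : Wᵀ * (MI (interval S.L) fun s =>
          (MI (interval S.L) fun ζ => greenKernel S.L S.B M N₁ N₂ s ζ * S.B₁ ζ)ᵀ * Z s) = bᵀ := by
      rw [← MI_const_mul _ (hKB.transpose.topMul hZ), hb, MI_transpose]
      simp only [Matrix.transpose_mul, Matrix.transpose_transpose, Matrix.mul_assoc]
    -- A scalar equals its transpose, so `D₁` and `D₁ᵀ` contribute equally.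
    have hD : (Wᵀ * (S.D₁ᵀ * W)) 0 0 = (Wᵀ * (S.D₁ * W)) 0 0 := by
      have : (Wᵀ * (S.D₁ * W))ᵀ = Wᵀ * (S.D₁ᵀ * W) := by
        simp only [Matrix.transpose_mul, Matrix.transpose_transpose, Matrix.mul_assoc]
      rw [← this]
      rfl
    rw [ip, intervalIntegral.integral_const, sub_zero, smul_eq_mul, inner_eq_colVec,
      colVec_opPQRSfst hL.le hQ (hu.memLp.mono_exponent one_le_two), hQZ, ← hW, passP,
      Matrix.mul_add, Matrix.mul_smul, Matrix.mul_add, hWb]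
    simp only [Matrix.neg_mul, Matrix.smul_mul, Matrix.add_mul, Matrix.mul_neg, Matrix.mul_smul,
      Matrix.mul_add, Matrix.add_apply, Matrix.neg_apply, Matrix.smul_apply, Matrix.transpose_apply,
      smul_eq_mul, hD]
    -- Integrating a constant over `[0, L]` gives a factor `L`, which cancels the `1 / L` in `passP`
    -- and in `opPQRSfst`.
    field_simp
    ring
  have hsnd : ip S.L uss (opPQRSsnd S.L (passQ S M N₁ N₂) (passR₁ S M N₁ N₂) (passR₂ S M N₁ N₂)
      w uss) = -(Wᵀ * c) 0 0 + b 0 0 + 2 * a 0 0 := by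
    have e : ∀ᵐ s ∂interval S.L, (colVec (uss s))ᵀ * colVec (opPQRSsnd S.L (passQ S M N₁ N₂)
          (passR₁ S M N₁ N₂) (passR₂ S M N₁ N₂) w uss s)
        = -((Z s)ᵀ * ((C₃ S s)ᵀ * W))
          + (Z s)ᵀ * ((MI (interval S.L) fun ζ => greenKernel S.L S.B M N₁ N₂ s ζ * S.B₁ ζ) * W)
          + ((Z s)ᵀ * (MI (interval S.L) fun θ => stateKernel S M N₁ N₂ s θ * Z θ)
          + (Z s)ᵀ * MI (interval S.L) fun θ => (stateKernel S M N₁ N₂ θ s)ᵀ * Z θ) := by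
      filter_upwards [ae_mem_interval S.L,
        MLp.ae_right (F := fun s θ => stateKernel S M N₁ N₂ s θ * Z θ) hHZ,
        MLp.ae_right (F := fun s θ => (stateKernel S M N₁ N₂ θ s)ᵀ * Z θ) hHZ'] with s hs i₁ i₂
      rw [colVec_opPQRSsnd hs
        (R := fun s θ => stateKernel S M N₁ N₂ s θ + (stateKernel S M N₁ N₂ θ s)ᵀ)
        (fun θ hθ h => (passR_eq hM h₁ h₂ hA₀ hA₁ hA₂ hs hθ).1 h)
        (fun θ hθ h => (passR_eq hM h₁ h₂ hA₀ hA₁ hA₂ hs hθ).2 h)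
        (by simpa only [Matrix.add_mul] using i₁.add i₂)]
      simp only [Matrix.add_mul]
      rw [MI_add i₁ i₂, passQ_eq hL.le h₁ h₂]
      simp only [Matrix.transpose_add, Matrix.transpose_neg, Matrix.transpose_transpose,
        Matrix.add_mul, Matrix.mul_add, Matrix.neg_mul, Matrix.mul_neg]
      rfl
    have zc' : MLp 1 (interval S.L) fun s => (Z s)ᵀ * ((C₃ S s)ᵀ * W) :=
      hZ.transpose.mulTop (hC.transpose.mulTop (.const W))
    have hWc : MI (interval S.L) (fun s => (Z s)ᵀ * ((C₃ S s)ᵀ * W)) = (Wᵀ * c)ᵀ := by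
      rw [← MI_const_mul _ zc, MI_transpose]
      simp only [Matrix.transpose_mul, Matrix.transpose_transpose, Matrix.mul_assoc]
    rw [ip_eq_MI hL.le, MI_congr e, MI_add (zc'.neg.add zb) (za.add za'), MI_add zc'.neg zb,
      MI_add za za', MI_neg, hWc, MI_transpose_mul_MI_transpose hH hZ]
    simp only [Matrix.add_apply, Matrix.neg_apply, Matrix.transpose_apply, ← ha, ← hb]
    ring
  -- The two components add up to `2 (a + b - Wᵀ c - Wᵀ D₁ W)`, hence `a + b ≤ Wᵀ c + Wᵀ D₁ W`.
  have h := hneg w uss hu.memLp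
  rw [hfst, hsnd] at h
  rw [hip, hsup]
  linarith

end dissipationInequality

/-! ### The operator on `L₂` and the storage function -/

section storage

variable {n : ℕ} {L : ℝ} {M : ℝ → Matrix (Fin n) (Fin n) ℝ}
  {N₁ N₂ : ℝ → ℝ → Matrix (Fin n) (Fin n) ℝ}

theorem colVec_opP_ae (h₁ : BddKernel L N₁) (h₂ : BddKernel L N₂) {x : ℝ → Vec n}
    (hx : MemLp x 2 (interval L)) : ∀ᵐ s ∂interval L, colVec (opP L M N₁ N₂ x s)
      = PK (interval L) M (piecewiseKernel N₁ N₂) (fun θ => colVec (x θ)) s := by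
  filter_upwards [ae_mem_interval L] with s hs
  exact colVec_opP h₁ h₂ (hx.mono_exponent one_le_two) hs

theorem memLp_opP (hM : MLp ⊤ (interval L) M) (h₁ : BddKernel L N₁) (h₂ : BddKernel L N₂)
    {x : ℝ → Vec n} (hx : MemLp x 2 (interval L)) : MemLp (opP L M N₁ N₂ x) 2 (interval L) := by
  refine MLp_colVec.1 ((MLp.PK one_le_two hM (h₁.piecewise h₂).prod (MLp_colVec.2 hx)).congr ?_)
  exact (colVec_opP_ae h₁ h₂ hx).mono fun s hs => hs.symm

/-- The integral terms see only the almost-everywhere class and the multiplier acts pointwise, so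
the operator descends to `L₂`. -/
theorem opP_congr (h₁ : BddKernel L N₁) (h₂ : BddKernel L N₂) {x y : ℝ → Vec n}
    (hx : MemLp x 2 (interval L)) (hxy : x =ᵐ[interval L] y) :
    opP L M N₁ N₂ x =ᵐ[interval L] opP L M N₁ N₂ y := by
  filter_upwards [colVec_opP_ae (M := M) h₁ h₂ hx, colVec_opP_ae (M := M) h₁ h₂ (hx.ae_eq hxy), hxy]
    with s e₁ e₂ e₃
  refine colVec_injective ?_
  rw [e₁, e₂, PK, PK, e₃]
  exact congrArg _ (MI_congr (hxy.mono fun θ hθ => by rw [hθ]))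

/-- `𝒫_{M,N₁,N₂}` as a linear map on `L₂`. -/
def opPLin (hM : MLp ⊤ (interval L) M) (h₁ : BddKernel L N₁) (h₂ : BddKernel L N₂) :
    StateSpace n L →ₗ[ℝ] StateSpace n L where
  toFun x := (memLp_opP hM h₁ h₂ (Lp.memLp x)).toLp _
  map_add' x y := by
    rw [← MemLp.toLp_add]
    refine MemLp.toLp_congr _ _ ?_
    have hx := MLp_colVec.2 ((Lp.memLp x).mono_exponent one_le_two)
    have hy := MLp_colVec.2 ((Lp.memLp y).mono_exponent one_le_two)
    filter_upwards [colVec_opP_ae (M := M) h₁ h₂ (Lp.memLp x),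
      colVec_opP_ae (M := M) h₁ h₂ (Lp.memLp y),
      colVec_opP_ae (M := M) h₁ h₂ ((Lp.memLp x).add (Lp.memLp y)),
      opP_congr (M := M) h₁ h₂ (Lp.memLp (x + y)) (Lp.coeFn_add x y)] with s e₁ e₂ e₃ e₄
    refine colVec_injective ?_
    rw [e₄, e₃, Pi.add_apply, colVec_add, e₁, e₂, ← PK_add (h₁.piecewise h₂) hx hy]
    rfl
  map_smul' c x := by
    rw [RingHom.id_apply, ← MemLp.toLp_const_smul]
    refine MemLp.toLp_congr _ _ ?_
    filter_upwards [colVec_opP_ae (M := M) h₁ h₂ (Lp.memLp x),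
      colVec_opP_ae (M := M) h₁ h₂ ((Lp.memLp x).const_smul c),
      opP_congr (M := M) h₁ h₂ (Lp.memLp (c • x)) (Lp.coeFn_smul c x)] with s e₁ e₂ e₃
    refine colVec_injective ?_
    rw [e₃, e₂, Pi.smul_apply, colVec_smul, e₁]
    simp only [PK, Pi.smul_apply, colVec_smul, Matrix.mul_smul, MI_smul, smul_add]

theorem ip_congr {k : ℕ} (hL : 0 ≤ L) {x x' y y' : ℝ → Vec k} (hx : x =ᵐ[interval L] x')
    (hy : y =ᵐ[interval L] y') : ip L x y = ip L x' y' := by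
  rw [ip, ip, intervalIntegral.integral_of_le hL, intervalIntegral.integral_of_le hL,
    ← integral_Icc_eq_integral_Ioc, ← integral_Icc_eq_integral_Ioc]
  refine integral_congr_ae ?_
  filter_upwards [hx, hy] with s e₁ e₂
  rw [e₁, e₂]

theorem inner_eq_ip (hL : 0 ≤ L) (x y : StateSpace n L) : inner ℝ x y = ip L x y := by
  rw [L2.inner_def, ip, intervalIntegral.integral_of_le hL, ← integral_Icc_eq_integral_Ioc]

/-- The representatives are free: for a solution, `u` is the `C¹` representative of the state and
`v` the right-hand side of the state equation. -/
theorem inner_opPLin (hL : 0 ≤ L) (hM : MLp ⊤ (interval L) M) (h₁ : BddKernel L N₁)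
    (h₂ : BddKernel L N₂) {x y : StateSpace n L} {u v : ℝ → Vec n}
    (hx : (x : ℝ → Vec n) =ᵐ[interval L] u) (hy : (y : ℝ → Vec n) =ᵐ[interval L] v) :
    inner ℝ x (opPLin hM h₁ h₂ y) = ip L u (opP L M N₁ N₂ v) := by
  rw [inner_eq_ip hL]
  exact ip_congr hL hx ((MemLp.coeFn_toLp (memLp_opP hM h₁ h₂ (Lp.memLp y))).trans
    (opP_congr h₁ h₂ (Lp.memLp y) hy))

theorem opPLin_isSymmetric (hL : 0 ≤ L) (hM : MLp ⊤ (interval L) M) (h₁ : BddKernel L N₁)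
    (h₂ : BddKernel L N₂) (hself : IsSelfAdjointOp L (opP L M N₁ N₂)) :
    (opPLin hM h₁ h₂).IsSymmetric := fun x y => by
  rw [real_inner_comm, inner_opPLin hL hM h₁ h₂ .rfl .rfl, inner_opPLin hL hM h₁ h₂ .rfl .rfl,
    ← hself _ _ (Lp.memLp x) (Lp.memLp y), ip, ip]
  simp only [real_inner_comm]

/-- The operator `𝒫_{M,N₁,N₂}` on `L₂`, bounded by the Hellinger--Toeplitz theorem. -/
def opPCLM (hL : 0 ≤ L) (hM : MLp ⊤ (interval L) M) (h₁ : BddKernel L N₁)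
    (h₂ : BddKernel L N₂) (hself : IsSelfAdjointOp L (opP L M N₁ N₂)) :
    StateSpace n L →L[ℝ] StateSpace n L :=
  ⟨opPLin hM h₁ h₂, (opPLin_isSymmetric hL hM h₁ h₂ hself).continuous⟩

end storage

/-! ### The energy identity in time. -/

section timeIntegration

variable {E : Type*} [NormedAddCommGroup E] [InnerProductSpace ℝ E]

/-- Symmetry exchanges the two triangles of the square, and their common diagonal is null because
`ν` has no atoms. -/
theorem integral_integral_eq_two_mul {ν : Measure ℝ} [SFinite ν] [NullSingletonClass ν]
    {g : ℝ → ℝ → ℝ}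
    (hg : Integrable (fun a : ℝ × ℝ => g a.1 a.2) (ν.prod ν)) (hs : ∀ a b, g a b = g b a) :
    ∫ b, ∫ a, g a b ∂ν ∂ν = 2 * ∫ b, ∫ a, ind (b - a) * g a b ∂ν ∂ν := by
  have hi : Integrable (fun a : ℝ × ℝ => ind (a.1 - a.2) * g a.2 a.1) (ν.prod ν) := by
    refine memLp_one_iff_integrable.1 ?_
    exact (memLp_one_iff_integrable.2 hg.swap).mul' (p := ⊤) (q := 1)
      (memLp_top_ind (f := fun a : ℝ × ℝ => a.1 - a.2) (by fun_prop))
  -- At `a = b` both indicators equal one, so this point has to be excluded.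
  have e : ∀ b, ∀ᵐ a ∂ν, g a b = ind (b - a) * g a b + ind (a - b) * g b a := by
    intro b
    filter_upwards [Measure.ae_ne ν b] with a hab
    rw [hs b a]
    rcases lt_or_gt_of_ne hab with h | h
    · rw [ind_of_nonneg (by linarith), ind_of_neg (by linarith)]
      ring
    · rw [ind_of_neg (by linarith), ind_of_nonneg (by linarith)]
      ring
  have h : ∫ b, ∫ a, g a b ∂ν ∂ν
      = ∫ b, ((∫ a, ind (b - a) * g a b ∂ν) + ∫ a, ind (a - b) * g b a ∂ν) ∂ν := by
    refine integral_congr_ae ?_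
    filter_upwards [hi.prod_right_ae, hi.swap.prod_right_ae] with b i₁ i₂
    rw [integral_congr_ae (e b)]
    exact integral_add i₁ i₂
  have i₁ : Integrable (fun b => ∫ a, ind (b - a) * g a b ∂ν) ν := hi.integral_prod_left
  have i₂ : Integrable (fun b => ∫ a, ind (a - b) * g b a ∂ν) ν := hi.swap.integral_prod_left
  rw [h, integral_add i₁ i₂,
    integral_integral_swap (f := fun b a => ind (a - b) * g b a) hi.swap, two_mul]

/-- Extending the primitive to all of `[0, τ]` by an indicator turns the power term into a section
of a function on the square. -/
theorem inner_primitive_eq_integral [CompleteSpace E] (T : E →L[ℝ] E) {f : ℝ → E} {τ : ℝ}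
    (hf : Integrable f (interval τ)) {t : ℝ} (ht : t ∈ Icc 0 τ) :
    inner ℝ (∫ r in (0 : ℝ)..t, f r) (T (f t))
      = ∫ r, ind (t - r) * inner ℝ (f r) (T (f t)) ∂interval τ := by
  have hif : Integrable (fun a => ind (t - a) • f a) (interval τ) :=
    memLp_one_iff_integrable.1 ((memLp_one_iff_integrable.2 hf).smul (p := ⊤) (q := 1)
      (memLp_top_ind (by fun_prop)))
  have e : ∫ r in (0 : ℝ)..t, f r = ∫ r, ind (t - r) • f r ∂interval τ := by
    rw [intervalIntegral_eq_integral_interval le_rfl ht.1 ht.2]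
    refine integral_congr_ae ?_
    filter_upwards [ae_mem_interval τ] with r hr
    rw [ind_of_nonneg (r := r - 0) (by linarith [hr.1]), one_mul]
  rw [e, real_inner_comm, ← integral_inner hif]
  refine congrArg _ (funext fun r => ?_)
  rw [real_inner_smul_right, real_inner_comm]

/-- The form is bounded by `‖T‖ ‖x‖ ‖y‖` and its arguments carry separate variables, so `f ∈ L¹`
suffices. -/
theorem integrable_inner_apply (T : E →L[ℝ] E) {f : ℝ → E} {ν : Measure ℝ} [SFinite ν]
    (hf : Integrable f ν) :
    Integrable (fun a : ℝ × ℝ => inner ℝ (f a.1) (T (f a.2))) (ν.prod ν) :=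
  hf.op_fst_snd (op := fun x y => inner ℝ x (T y)) (by fun_prop)
    ⟨‖T‖, fun x y => by
      refine (norm_inner_le_norm x (T y)).trans ?_
      have := mul_le_mul_of_nonneg_left (T.le_opNorm y) (norm_nonneg x)
      linarith⟩ hf

/-- Integrability of the power is inherited from the square through Fubini. -/
theorem integrable_inner_primitive [CompleteSpace E] (T : E →L[ℝ] E) {f : ℝ → E} {τ : ℝ}
    (hf : Integrable f (interval τ)) :
    Integrable (fun t => inner ℝ (∫ r in (0 : ℝ)..t, f r) (T (f t))) (interval τ) := by
  have hi : Integrable (fun a : ℝ × ℝ => ind (a.1 - a.2) * inner ℝ (f a.2) (T (f a.1)))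
      ((interval τ).prod (interval τ)) :=
    memLp_one_iff_integrable.1 ((memLp_one_iff_integrable.2 (integrable_inner_apply T hf).swap).mul'
      (p := ⊤) (q := 1) (memLp_top_ind (f := fun a : ℝ × ℝ => a.1 - a.2) (by fun_prop)))
  refine hi.integral_prod_left.congr ?_
  filter_upwards [ae_mem_interval τ] with t ht
  rw [inner_primitive_eq_integral T hf ht]

/-- The energy identity `⟨x(τ), T x(τ)⟩ = 2 ∫₀^τ ⟨x(t), T ẋ(t)⟩ dt` for `x(t) = ∫₀ᵗ ẋ`. -/
theorem inner_primitive_eq [CompleteSpace E] {T : E →L[ℝ] E} (hT : (T : E →ₗ[ℝ] E).IsSymmetric)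
    {f : ℝ → E} {τ : ℝ}
    (hτ : 0 ≤ τ) (hf : Integrable f (interval τ)) :
    inner ℝ (∫ t in (0 : ℝ)..τ, f t) (T (∫ t in (0 : ℝ)..τ, f t))
      = 2 * ∫ t, inner ℝ (∫ r in (0 : ℝ)..t, f r) (T (f t)) ∂interval τ := by
  have hTf : Integrable (fun t => T (f t)) (interval τ) := T.integrable_comp hf
  have h₀ := integral_integral_eq_two_mul (g := fun a b => inner ℝ (f a) (T (f b)))
    (integrable_inner_apply T hf) fun a b => (hT (f a) (f b)).symm.trans (real_inner_comm _ _)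
  have e₁ : ∫ t in (0 : ℝ)..τ, f t = ∫ t, f t ∂interval τ := by
    rw [intervalIntegral.integral_of_le hτ, ← integral_Icc_eq_integral_Ioc]
  -- Both arguments are integrals, so continuity of `T` and of the inner product spreads the energy
  -- over the square.
  have e₃ : inner ℝ (∫ t, f t ∂interval τ) (T (∫ t, f t ∂interval τ))
      = ∫ b, ∫ a, inner ℝ (f a) (T (f b)) ∂interval τ ∂interval τ := by
    rw [← T.integral_comp_comm hf, ← integral_inner hTf]
    refine integral_congr_ae (Filter.Eventually.of_forall fun b => ?_)
    dsimp only
    rw [real_inner_comm, ← integral_inner hf]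
    simp only [real_inner_comm]
  rw [e₁, e₃, h₀]
  refine congrArg _ (integral_congr_ae ?_)
  filter_upwards [ae_mem_interval τ] with b hb
  rw [inner_primitive_eq_integral T hf hb]

end timeIntegration

/-! ### Polynomial kernels -/

section polynomial

variable {n : ℕ}

theorem MLp_polyFun (L : ℝ) (M : Matrix (Fin n) (Fin n) (Polynomial ℝ)) :
    MLp ⊤ (interval L) (polyFun M) :=
  (compactlyCarried_interval L).MLp_top (continuous_matrix fun i j => (M i j).continuous)

theorem bddKernel_polyFun₂ (L : ℝ) (N : Matrix (Fin n) (Fin n) (MvPolynomial (Fin 2) ℝ)) :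
    BddKernel L (polyFun₂ N) := by
  refine .of_continuous (continuous_matrix fun i j => ?_)
  refine (MvPolynomial.continuous_eval (N i j)).comp (g := fun v => MvPolynomial.eval v (N i j))
    (f := fun a : ℝ × ℝ => ![a.1, a.2]) (continuous_pi fun i => ?_)
  fin_cases i <;> simp <;> fun_prop

end polynomial

end CoupledPDE

end

/-! ### Passivity from the dissipation inequality. -/

theorem mainTheorem3 {n q : ℕ} (S : CoupledPDE.PDESystem n q q)
    (hL : 0 < S.L)
    (hA₀ : CoupledPDE.EssBounded S.L S.A₀) (hA₁ : CoupledPDE.EssBounded S.L S.A₁)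
    (hA₂ : CoupledPDE.EssBounded S.L S.A₂) (hB₁ : CoupledPDE.EssBounded S.L S.B₁)
    (hCa : CoupledPDE.EssBounded S.L S.Ca) (hCb : CoupledPDE.EssBounded S.L S.Cb)
    (hB : IsUnit (CoupledPDE.bcMat S.L S.B))
    (M : Matrix (Fin n) (Fin n) (Polynomial ℝ))
    (N₁ N₂ : Matrix (Fin n) (Fin n) (MvPolynomial (Fin 2) ℝ))
    (hself : CoupledPDE.IsSelfAdjointOp S.L (CoupledPDE.opP S.L (CoupledPDE.polyFun M)
      (CoupledPDE.polyFun₂ N₁) (CoupledPDE.polyFun₂ N₂)))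
    (hcoer : CoupledPDE.IsCoerciveOp S.L (CoupledPDE.opP S.L (CoupledPDE.polyFun M)
      (CoupledPDE.polyFun₂ N₁) (CoupledPDE.polyFun₂ N₂)))
    (hneg : CoupledPDE.PQRSNonpos S.L (CoupledPDE.passP S)
      (CoupledPDE.passQ S (CoupledPDE.polyFun M) (CoupledPDE.polyFun₂ N₁) (CoupledPDE.polyFun₂ N₂))
      (CoupledPDE.passR₁ S (CoupledPDE.polyFun M) (CoupledPDE.polyFun₂ N₁)
        (CoupledPDE.polyFun₂ N₂))
      (CoupledPDE.passR₂ S (CoupledPDE.polyFun M) (CoupledPDE.polyFun₂ N₁)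
        (CoupledPDE.polyFun₂ N₂)))
    (w y : ℝ → CoupledPDE.Vec q) (x : ℝ → CoupledPDE.StateSpace n S.L)
    (hw : MeasureTheory.MemLp w 2 (MeasureTheory.volume.restrict (Set.Ici (0 : ℝ))))
    (hy : MeasureTheory.MemLp y 2 (MeasureTheory.volume.restrict (Set.Ici (0 : ℝ))))
    (hsol : CoupledPDE.IsSolution S w x y) :
    0 ≤ ∫ t in Set.Ici (0 : ℝ), inner ℝ (w t) (y t) := by
  have hM := CoupledPDE.MLp_polyFun S.L M
  have h₁ := CoupledPDE.bddKernel_polyFun₂ S.L N₁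
  have h₂ := CoupledPDE.bddKernel_polyFun₂ S.L N₂
  obtain ⟨xdot, hint, hx, hae⟩ := hsol
  obtain ⟨ε, hε, hcoer⟩ := hcoer
  set T := CoupledPDE.opPCLM hL.le hM h₁ h₂ hself
  have hT : (T : CoupledPDE.StateSpace n S.L →ₗ[ℝ] CoupledPDE.StateSpace n S.L).IsSymmetric :=
    CoupledPDE.opPLin_isSymmetric hL.le hM h₁ h₂ hself
  -- Cauchy–Schwarz: the supply rate is a product of two `L₂` functions, so its integral over `[0,
  -- ∞)` is a genuine limit of integrals over `[0, τ]`.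
  have hwy : IntegrableOn (fun t => inner ℝ (w t) (y t)) (Ici 0) := by
    simp only [CoupledPDE.inner_eq_colVec]
    exact ((CoupledPDE.MLp_colVec.2 hw).transpose.mul_two
      (CoupledPDE.MLp_colVec.2 hy)).integrable 0 0
  have hdiss : ∀ᵐ t ∂(volume.restrict (Ici (0 : ℝ))),
      inner ℝ (∫ r in (0 : ℝ)..t, xdot r) (T (xdot t)) ≤ inner ℝ (w t) (y t) := by
    filter_upwards [hae, ae_restrict_mem measurableSet_Ici] with t ht ht0
    obtain ⟨u, us, uss, hu, hxu, hbc, hxd, hyt⟩ := ht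
    rw [← hx t ht0, hyt]
    exact (CoupledPDE.inner_opPLin hL.le hM h₁ h₂ hxu hxd).trans_le
      (CoupledPDE.ip_opP_stateRhs_le hL hA₀ hA₁ hA₂ hB₁ hCa hCb hB hM h₁ h₂ hneg hu hbc (w t))
  have hpos : ∀ τ : ℝ, 0 ≤ τ → 0 ≤ ∫ t in (0 : ℝ)..τ, inner ℝ (w t) (y t) := by
    intro τ hτ
    have hf : Integrable xdot (CoupledPDE.interval τ) :=
      (integrableOn_Icc_iff_integrableOn_Ioc).2
        ((intervalIntegrable_iff_integrableOn_Ioc_of_le hτ).1 (hint τ hτ))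
    -- Coercivity enters as nonnegativity of the storage function at the final time.
    have hV : 0 ≤ inner ℝ (x τ) (T (x τ)) := by
      have e : inner ℝ (x τ) (T (x τ)) = _ := CoupledPDE.inner_opPLin hL.le hM h₁ h₂ .rfl .rfl
      rw [e]
      refine le_trans (mul_nonneg hε.le ?_) (hcoer _ (Lp.memLp (x τ)))
      rw [← CoupledPDE.inner_eq_ip hL.le]
      exact real_inner_self_nonneg
    -- The initial storage is absent because `x` is the primitive of `xdot` vanishing at time zero.
    rw [hx τ hτ, CoupledPDE.inner_primitive_eq hT hτ hf] at hV
    rw [intervalIntegral.integral_of_le hτ, ← integral_Icc_eq_integral_Ioc]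
    have hle := integral_mono_ae (CoupledPDE.integrable_inner_primitive T hf)
      (hwy.mono_set Icc_subset_Ici_self)
      (ae_restrict_of_ae_restrict_of_subset Icc_subset_Ici_self hdiss)
    linarith
  rw [integral_Ici_eq_integral_Ioi]
  refine ge_of_tendsto (intervalIntegral_tendsto_integral_Ioi 0
    (hwy.mono_set Ioi_subset_Ici_self) Filter.tendsto_id) ?_
  filter_upwards [Filter.eventually_ge_atTop 0] with τ hτ
  exact hpos τ hτ
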